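/- Let $(h_n)_{n\ge 0}$ be the Hermite functions, the orthonormal basis of $L^2(\mathbb R)$ with $Nh_n=nh_n$, where $N=\frac12(X^2+P^2-1)$, $(Xf)(x)=xf(x)$, $Pf=-if'$. For $\theta\in[0,2\pi]$ let $V(\theta)=e^{i\theta N}$ be the unitary operator with $V(\theta)h_n=e^{i\theta n}h_n$, and let $\Pi_\theta(A)=V(\theta)\,1_A\,V(\theta)^*$ for Borel $A\subseteq\mathbb R$, where $1_A$ is multiplication by the indicator function of $A$; this is the spectral measure of the quadrature $X_\theta=\cos\theta\,X+\sin\theta\,P$. Let $\rho$ be a state on $L^2(\mathbb R)$, i.e. a positive trace class operator with $\operatorname{tr}\rho=1$. Let $\mu^\rho$ be the homodyne probability measure on $[0,2\pi]\times\mathbb R$, $\mu^\rho(B)=\int_0^{2\pi}\operatorname{tr}\big(\rho\,\Pi_\theta(B^\theta)\big)\frac{d\theta}{2\pi}$ for Borel $B$, where $B^\theta=\{x\mid(\theta,x)\in B\}$, and let $p^\rho$ be its density with respect to $\frac{d\theta}{2\pi}\,dx$. Let $[V(\rho)](x,y)=\frac1{\sqrt{2\pi}}\operatorname{tr}\big(\rho\,e^{i(xX+yP)}\big)$,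 where $[e^{i(xX+yP)}f](z)=e^{i(xy/2+xz)}f(z+y)$, and let the Wigner function be $W(\rho)=\frac1{\sqrt{2\pi}}\mathcal F_2V(\rho)$, where $\mathcal F_2$ is the unitary Fourier transform on $L^2(\mathbb R^2)$ given by $\mathcal F_2u(\xi)=\frac1{2\pi}\int_{\mathbb R^2}e^{-i\xi\cdot q}u(q)\,dq$ for $u\in L^1\cap L^2$. Then $V(\rho)\in L^2(\mathbb R^2)$ and the density $p^\rho$ exists (so that $W(\rho)$ and $p^\rho$ are well defined almost everywhere). If moreover $W(\rho)\in L^1(\mathbb R^2)$, then its Radon transform $$[RW(\rho)](\theta,r)=\int_{-\infty}^{+\infty}[W(\rho)](r\cos\theta-t\sin\theta,\;r\sin\theta+t\cos\theta)\,dt$$ is given by a convergent Lebesgue integral for almost every $(\theta,r)\in[0,2\pi]\times\mathbb R$, is integrable with respect to $\frac{d\theta}{2\pi}\,dr$, and satisfies $$[RW(\rho)](\theta,r)=p^\rho(\theta,r)\qquad\text{for }\tfrac{d\theta}{2\pi}\,dr\text{-almost all }(\theta,r).$$ -/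

import Mathlib

open MeasureTheory

namespace Homodyne

/-- The Hilbert space `L²(ℝ)`. -/
abbrev L2R : Type := Lp (α := ℝ) ℂ 2

/-! ### The number basis -/

/-- The polynomial `x ↦ He_n(√2 x)` (equal to `2^{-n/2} H_n(x)`), `He_n` and `H_n` being the
probabilists' and physicists' Hermite polynomials. -/
noncomputable def hermitePoly (n : ℕ) : Polynomial ℝ :=
  ((Polynomial.hermite n).map (Int.castRingHom ℝ)).comp
    (Polynomial.C (Real.sqrt 2) * Polynomial.X)

/-- The normalized Hermite functions
`h_n(x) = (n! √π)^{-1/2} He_n(√2 x) e^{-x²/2} = (2^n n! √π)^{-1/2} H_n(x) e^{-x²/2}`. -/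
noncomputable def hermiteFun (n : ℕ) (x : ℝ) : ℝ :=
  (Real.sqrt ((n.factorial : ℝ) * Real.sqrt Real.pi))⁻¹ * (hermitePoly n).eval x
    * Real.exp (-x ^ 2 / 2)

section HermiteFacts

open Polynomial

lemma derivative_hermite_succ (n : ℕ) :
    derivative (hermite (n + 1)) = ((n : ℤ[X]) + 1) * hermite n := by
  induction n with
  | zero => simp
  | succ n ih =>
    rw [hermite_succ (n + 1), derivative_sub, derivative_mul, ih, derivative_mul]
    have h := hermite_succ n
    have h2 : derivative ((n : ℤ[X]) + 1) = 0 := by simp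
    rw [h2, derivative_X, h]
    push_cast
    ring

lemma derivative_hermitePoly (n : ℕ) :
    derivative (hermitePoly n) = C (Real.sqrt 2) *
      ((derivative (hermite n)).map (Int.castRingHom ℝ)).comp (C (Real.sqrt 2) * X) := by
  simp [hermitePoly, derivative_comp, derivative_map]

lemma hermitePoly_succ (n : ℕ) :
    C (Real.sqrt 2) * hermitePoly (n + 1)
      = 2 * X * hermitePoly n - derivative (hermitePoly n) := by
  have h2 : (C (Real.sqrt 2) * C (Real.sqrt 2) : ℝ[X]) = 2 := by
    rw [← C_mul, Real.mul_self_sqrt (by norm_num)]; rfl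
  rw [derivative_hermitePoly]
  simp only [hermitePoly, hermite_succ, Polynomial.map_sub, Polynomial.map_mul, map_X, sub_comp,
    mul_comp, X_comp]
  rw [← h2]
  ring

lemma derivative_hermitePoly_succ (n : ℕ) :
    derivative (hermitePoly (n + 1)) = C (Real.sqrt 2) * ((n : ℝ[X]) + 1) * hermitePoly n := by
  rw [derivative_hermitePoly, derivative_hermite_succ]
  simp [hermitePoly, mul_assoc]

lemma natDegree_hermitePoly (n : ℕ) : (hermitePoly n).natDegree = n := by
  have h2 : Real.sqrt 2 ≠ 0 := by positivity
  rw [hermitePoly, natDegree_comp, natDegree_C_mul h2, natDegree_X, mul_one,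
    (hermite_monic n).natDegree_map, natDegree_hermite]

/-- The number operator `(X² + P² - 1)/2`, with `X f = x f` and `P f = -i f'`, as a differential
operator acting on functions. -/
noncomputable def numberDiffOp (f : ℝ → ℝ) (x : ℝ) : ℝ :=
  (x ^ 2 * f x - deriv (deriv f) x - f x) / 2

lemma hasDerivAt_poly_gauss (p : ℝ[X]) (x : ℝ) :
    HasDerivAt (fun y : ℝ => p.eval y * Real.exp (-y ^ 2 / 2))
      ((derivative p - X * p).eval x * Real.exp (-x ^ 2 / 2)) x := by
  have h1 : HasDerivAt (fun y : ℝ => -y ^ 2 / 2) (-x) x := by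
    have := ((hasDerivAt_pow 2 x).neg).div_const 2
    refine this.congr_deriv ?_
    simp; ring
  refine ((p.hasDerivAt x).mul h1.exp).congr_deriv ?_
  simp; ring

/-- The Hermite functions are eigenfunctions of the number operator: `N h_n = n h_n`. -/
theorem numberDiffOp_hermiteFun (n : ℕ) (x : ℝ) :
    numberDiffOp (hermiteFun n) x = n * hermiteFun n x := by
  set c := (Real.sqrt ((n.factorial : ℝ) * Real.sqrt Real.pi))⁻¹ with hc
  set p := C c * hermitePoly n with hp
  have hf : hermiteFun n = fun y => p.eval y * Real.exp (-y ^ 2 / 2) := by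
    funext y; simp [hermiteFun, hp, hc]
  have hd (q : ℝ[X]) : deriv (fun y : ℝ => q.eval y * Real.exp (-y ^ 2 / 2))
      = fun y => (derivative q - X * q).eval y * Real.exp (-y ^ 2 / 2) := by
    funext y; exact (hasDerivAt_poly_gauss q y).deriv
  have ode : 2 * X * derivative (hermitePoly n) - derivative (derivative (hermitePoly n))
      = 2 * (n : ℝ[X]) * hermitePoly n := by
    cases n with
    | zero =>
      have : derivative (hermitePoly 0) = 0 := by simp [hermitePoly]
      simp [this]
    | succ n =>
      have h2 : (C (Real.sqrt 2) * C (Real.sqrt 2) : ℝ[X]) = 2 := by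
        rw [← C_mul, Real.mul_self_sqrt (by norm_num)]; rfl
      have h3 : derivative (C (Real.sqrt 2) * ((n : ℝ[X]) + 1)) = 0 := by simp
      rw [derivative_hermitePoly_succ, derivative_mul, h3]
      push_cast
      linear_combination (C (Real.sqrt 2) * ((n : ℝ[X]) + 1)) * (- hermitePoly_succ n)
        + ((n : ℝ[X]) + 1) * hermitePoly (n + 1) * h2
  have ode' := congrArg (fun q => c * eval x q) ode
  simp only [numberDiffOp, hf, hd]
  simp only [hp, derivative_mul, derivative_C, derivative_X, derivative_sub,
    zero_mul, zero_add, eval_sub, eval_mul,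
    eval_add, eval_X, eval_C, eval_natCast, eval_one, eval_ofNat] at ode' ⊢
  linear_combination (Real.exp (-x ^ 2 / 2) / 2) * ode'

lemma integrable_poly_gauss (p : ℝ[X]) {b : ℝ} (hb : 0 < b) :
    Integrable (fun x : ℝ => p.eval x * Real.exp (-b * x ^ 2)) := by
  induction p using Polynomial.induction_on' with
  | add p q hp hq =>
    refine (hp.add hq).congr (Filter.Eventually.of_forall fun x => ?_)
    simp [add_mul]
  | monomial n a =>
    have := (integrable_rpow_mul_exp_neg_mul_sq hb (s := (n : ℝ))
      (by have := n.cast_nonneg (α := ℝ); linarith)).const_mul a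
    simpa [mul_assoc, eval_monomial] using this

lemma memLp_poly_gauss (p : ℝ[X]) :
    MemLp (fun x : ℝ => p.eval x * Real.exp (-x ^ 2 / 2)) 2 := by
  rw [memLp_two_iff_integrable_sq]
  · refine (integrable_poly_gauss (p ^ 2) one_pos).congr (Filter.Eventually.of_forall fun x => ?_)
    simp only [eval_pow, mul_pow, ← Real.exp_nat_mul]
    congr 2; push_cast; ring
  · exact (by fun_prop : Continuous fun x : ℝ => p.eval x * Real.exp (-x ^ 2 / 2)).aestronglyMeasurable

lemma memLp_hermiteFun (n : ℕ) : MemLp (fun x => (hermiteFun n x : ℂ)) 2 := by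
  have h : MemLp (hermiteFun n) 2 := by
    have := memLp_poly_gauss (C (Real.sqrt ((n.factorial : ℝ) * Real.sqrt Real.pi))⁻¹ * hermitePoly n)
    refine this.ae_eq (Filter.Eventually.of_forall fun x => ?_)
    simp [hermiteFun]
  exact h.ofReal

/-- One integration by parts. -/
lemma integral_mul_hermitePoly_succ (p : ℝ[X]) (n : ℕ) :
    Real.sqrt 2 * ∫ x : ℝ, (p * hermitePoly (n + 1)).eval x * Real.exp (-1 * x ^ 2)
      = ∫ x : ℝ, (derivative p * hermitePoly n).eval x * Real.exp (-1 * x ^ 2) := by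
  have hv : ∀ x : ℝ, HasDerivAt (fun y => (hermitePoly n).eval y * Real.exp (-1 * y ^ 2))
      (-(Real.sqrt 2 * ((hermitePoly (n + 1)).eval x * Real.exp (-1 * x ^ 2)))) x := by
    intro x
    have h1 : HasDerivAt (fun y : ℝ => -1 * y ^ 2) (-2 * x) x := by
      refine ((hasDerivAt_pow 2 x).const_mul (-1)).congr_deriv ?_
      simp
    refine (((hermitePoly n).hasDerivAt x).mul h1.exp).congr_deriv ?_
    have := congrArg (eval x) (hermitePoly_succ n)
    simp only [eval_mul, eval_C, eval_sub, eval_X, eval_ofNat] at this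
    linear_combination (Real.exp (-1 * x ^ 2)) * this
  have hib (q : ℝ[X]) := integrable_poly_gauss q one_pos
  have key := integral_mul_deriv_eq_deriv_mul_of_integrable (u := fun x => p.eval x)
    (v := fun y => (hermitePoly n).eval y * Real.exp (-1 * y ^ 2))
    (u' := fun x => (derivative p).eval x) (fun x _ => p.hasDerivAt x) (fun x _ => hv x) ?_ ?_ ?_
  · rw [← integral_const_mul]
    have e1 : (fun x : ℝ => Real.sqrt 2 * ((p * hermitePoly (n + 1)).eval x * Real.exp (-1 * x ^ 2)))
        = fun x => -(p.eval x * -(Real.sqrt 2 * ((hermitePoly (n + 1)).eval x * Real.exp (-1 * x ^ 2)))) := by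
      funext x; simp only [eval_mul]; ring
    rw [e1, integral_neg, key, neg_neg]
    congr 1; funext x; simp only [eval_mul]; ring
  · refine ((hib (C (-Real.sqrt 2) * p * hermitePoly (n + 1)))).congr (Filter.Eventually.of_forall fun x => ?_)
    simp; ring
  · refine (hib (derivative p * hermitePoly n)).congr (Filter.Eventually.of_forall fun x => ?_)
    simp; ring
  · refine (hib (p * hermitePoly n)).congr (Filter.Eventually.of_forall fun x => ?_)
    simp; ring

lemma integral_hermitePoly_mul (m n : ℕ) (h : m ≤ n) :
    ∫ x : ℝ, (hermitePoly m * hermitePoly n).eval x * Real.exp (-1 * x ^ 2)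
      = if m = n then (n.factorial : ℝ) * Real.sqrt Real.pi else 0 := by
  have h2 : Real.sqrt 2 ≠ 0 := by positivity
  induction n generalizing m with
  | zero =>
    obtain rfl : m = 0 := by omega
    have := integral_gaussian 1
    simp only [div_one] at this
    simpa [hermitePoly] using this
  | succ n ih =>
    apply mul_left_cancel₀ h2
    rw [integral_mul_hermitePoly_succ]
    cases m with
    | zero =>
      have : derivative (hermitePoly 0) = 0 := by simp [hermitePoly]
      simp [this]
    | succ m =>
      have e : (fun x : ℝ => (derivative (hermitePoly (m + 1)) * hermitePoly n).eval x
          * Real.exp (-1 * x ^ 2)) = fun x => (Real.sqrt 2 * (m + 1)) *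
          ((hermitePoly m * hermitePoly n).eval x * Real.exp (-1 * x ^ 2)) := by
        funext x
        rw [derivative_hermitePoly_succ]
        simp only [eval_mul, eval_C, eval_add, eval_natCast, eval_one]
        ring
      rw [e, integral_const_mul, ih m (by omega)]
      by_cases hmn : m = n
      · subst hmn
        simp [Nat.factorial_succ]; ring
      · simp [hmn]

end HermiteFacts

/-- The number state `h_n` as an element of `L²(ℝ)`. -/
noncomputable def numberState (n : ℕ) : L2R := (memLp_hermiteFun n).toLp


lemma integral_hermiteFun_mul (m n : ℕ) :
    ∫ x, hermiteFun m x * hermiteFun n x = if m = n then 1 else 0 := by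
  wlog h : m ≤ n generalizing m n
  · have := this n m (by omega)
    simp only [mul_comm (hermiteFun n _), eq_comm (a := n)] at this
    exact this
  have e : (fun x : ℝ => hermiteFun m x * hermiteFun n x) = fun x =>
      ((Real.sqrt ((m.factorial : ℝ) * Real.sqrt Real.pi))⁻¹
        * (Real.sqrt ((n.factorial : ℝ) * Real.sqrt Real.pi))⁻¹) *
      ((hermitePoly m * hermitePoly n).eval x * Real.exp (-1 * x ^ 2)) := by
    funext x
    have : Real.exp (-1 * x ^ 2) = Real.exp (-x ^ 2 / 2) * Real.exp (-x ^ 2 / 2) := by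
      rw [← Real.exp_add]; congr 1; ring
    rw [this, Polynomial.eval_mul, hermiteFun, hermiteFun]; ring
  rw [e, integral_const_mul, integral_hermitePoly_mul m n h]
  split_ifs with hmn
  · subst hmn
    have hpos : 0 < (m.factorial : ℝ) * Real.sqrt Real.pi := by positivity
    rw [← mul_inv, Real.mul_self_sqrt hpos.le, inv_mul_cancel₀ hpos.ne']
  · simp

lemma orthonormal_numberState : Orthonormal ℂ numberState := by
  rw [orthonormal_iff_ite]
  intro m n
  have h1 : inner ℂ (numberState m) (numberState n)
      = ∫ x, ((hermiteFun m x * hermiteFun n x : ℝ) : ℂ) := by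
    rw [L2.inner_def]
    refine integral_congr_ae ?_
    filter_upwards [(memLp_hermiteFun m).coeFn_toLp, (memLp_hermiteFun n).coeFn_toLp] with x hm hn
    simp only [numberState, hm, hn]
    simp [mul_comm]
  rw [h1, integral_complex_ofReal, integral_hermiteFun_mul]
  split_ifs <;> simp

section Completeness

open Polynomial FourierTransform

lemma span_hermitePoly : Submodule.span ℝ (Set.range hermitePoly) = ⊤ := by
  have hne (i : ℕ) : hermitePoly i ≠ 0 := by
    intro h0
    cases i with
    | zero =>
      have : hermitePoly 0 = 1 := by simp [hermitePoly]
      rw [this] at h0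
      exact one_ne_zero h0
    | succ i =>
      have := natDegree_hermitePoly (i + 1)
      rw [h0] at this
      simp at this
  let S : Polynomial.Sequence ℝ := ⟨hermitePoly, fun i => by
    rw [degree_eq_natDegree (hne i), natDegree_hermitePoly]⟩
  exact S.span fun i => isUnit_iff_ne_zero.mpr (leadingCoeff_ne_zero.mpr (hne i))

lemma ae_eq_zero_of_fourier_eq_zero {g : ℝ → ℂ} (hg : Integrable g) (h : ∀ w, 𝓕 g w = 0) :
    ∀ᵐ x, g x = 0 := by
  apply ae_eq_zero_of_integral_contDiff_smul_eq_zero hg.locallyIntegrable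
  intro u u_smooth u_cpt
  have hu₁ : HasCompactSupport (Complex.ofRealCLM ∘ u) := u_cpt.comp_left rfl
  have hu₂ : ContDiff ℝ ((⊤ : ℕ∞) : WithTop ℕ∞) (Complex.ofRealCLM ∘ u) := by fun_prop
  set ψ : SchwartzMap ℝ ℂ := hu₁.toSchwartzMap hu₂ with hψ
  have h1 := VectorFourier.integral_fourierIntegral_smul_eq_flip (L := innerₗ ℝ)
    Real.continuous_fourierChar continuous_inner ((𝓕⁻ ψ).integrable (μ := volume)) hg
  rw [flip_innerₗ] at h1
  change ∫ x, 𝓕 (⇑(𝓕⁻ ψ : SchwartzMap ℝ ℂ)) x • g x = ∫ x, (𝓕⁻ ψ : SchwartzMap ℝ ℂ) x • 𝓕 g x at h1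
  rw [← SchwartzMap.fourier_coe, FourierTransform.fourier_fourierInv_eq] at h1
  simp only [h, smul_zero, integral_zero] at h1
  rw [← h1]
  simp [hψ]

lemma memLp_exp_abs_gauss (c : ℝ) :
    MemLp (fun x : ℝ => Real.exp (c * |x| - x ^ 2 / 2)) 2 := by
  have hc : Continuous fun x : ℝ => Real.exp (c * |x| - x ^ 2 / 2) := by fun_prop
  rw [memLp_two_iff_integrable_sq hc.aestronglyMeasurable]
  refine ((integrable_exp_neg_mul_sq (b := 1 / 2) (by norm_num)).const_mul
    (Real.exp (2 * c ^ 2))).mono' (hc.pow 2).aestronglyMeasurable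
    (Filter.Eventually.of_forall fun x => ?_)
  rw [Real.norm_of_nonneg (by positivity), ← Real.exp_nat_mul, ← Real.exp_add, Real.exp_le_exp]
  push_cast
  nlinarith [sq_nonneg (|x| - 2 * c), sq_abs x]

lemma eq_zero_of_inner_numberState (f : L2R) (hf : ∀ n, inner ℂ (numberState n) f = 0) :
    f = 0 := by
  have hfL := Lp.memLp f
  set g : ℝ → ℂ := fun x => (Real.exp (-x ^ 2 / 2) : ℂ) * f x with hgdef
  have hexp (c : ℝ) : Integrable (fun x => Real.exp (c * |x|) * ‖g x‖) := by
    have := (memLp_exp_abs_gauss c).integrable_mul hfL.norm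
    refine this.congr (Filter.Eventually.of_forall fun x => ?_)
    simp only [hgdef, Pi.mul_apply, norm_mul, Complex.norm_real, Real.norm_eq_abs, Real.abs_exp,
      ← mul_assoc, ← Real.exp_add]
    congr 2; ring
  have hgm : AEStronglyMeasurable g volume :=
    (by fun_prop : Continuous fun x : ℝ => (Real.exp (-x ^ 2 / 2) : ℂ)).aestronglyMeasurable.mul
      hfL.aestronglyMeasurable
  have hg : Integrable g := by
    refine (integrable_norm_iff hgm).mp ?_
    simpa using hexp 0
  have hpi (p : ℝ[X]) : Integrable (fun x => ((p.eval x : ℝ) : ℂ) * g x) := by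
    have := (memLp_poly_gauss p).ofReal (K := ℂ) |>.integrable_mul hfL
    refine this.congr (Filter.Eventually.of_forall fun x => ?_)
    simp [hgdef, mul_assoc]
  have hq (n : ℕ) : ∫ x, (((hermitePoly n).eval x : ℝ) : ℂ) * g x = 0 := by
    have h1 := hf n
    rw [L2.inner_def] at h1
    have hpos : 0 < Real.sqrt ((n.factorial : ℝ) * Real.sqrt Real.pi) := by positivity
    have h2 : ∫ x, (((Real.sqrt ((n.factorial : ℝ) * Real.sqrt Real.pi))⁻¹ : ℝ) : ℂ) *
        ((((hermitePoly n).eval x : ℝ) : ℂ) * g x) = 0 := by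
      rw [← h1]
      refine integral_congr_ae ?_
      filter_upwards [(memLp_hermiteFun n).coeFn_toLp] with x hx
      rw [numberState, hx]
      simp only [hgdef, hermiteFun, RCLike.inner_apply, Complex.conj_ofReal]
      push_cast
      ring
    rw [integral_const_mul] at h2
    rcases mul_eq_zero.mp h2 with h3 | h3
    · exact absurd (Complex.ofReal_eq_zero.mp h3) (inv_ne_zero hpos.ne')
    · exact h3
  have hp (p : ℝ[X]) : ∫ x, ((p.eval x : ℝ) : ℂ) * g x = 0 := by
    have hmem : p ∈ Submodule.span ℝ (Set.range hermitePoly) := by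
      rw [span_hermitePoly]; trivial
    induction hmem using Submodule.span_induction with
    | mem q hq' => obtain ⟨n, rfl⟩ := hq'; exact hq n
    | zero => simp
    | add q r _ _ h1 h2 =>
      have := integral_add (hpi q) (hpi r)
      rw [h1, h2, add_zero] at this
      rw [← this]
      congr 1; funext x; simp [add_mul]
    | smul a q _ h1 =>
      have := integral_const_mul (μ := volume) (a : ℂ) (fun x => ((q.eval x : ℝ) : ℂ) * g x)
      rw [h1, mul_zero] at this
      rw [← this]
      congr 1; funext x; simp [mul_assoc]
  have hF (w : ℝ) : 𝓕 g w = 0 := by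
    rw [Real.fourier_real_eq_integral_exp_smul]
    have key := hasSum_integral_of_dominated_convergence (μ := volume)
      (F := fun (k : ℕ) (x : ℝ) => ((-2 * Real.pi * w * Complex.I) ^ k / k.factorial) *
        ((((X ^ k : ℝ[X]).eval x : ℝ) : ℂ) * g x))
      (f := fun x : ℝ => Complex.exp (((-2 * Real.pi * x * w : ℝ) : ℂ) * Complex.I) • g x)
      (fun k x => ((2 * Real.pi * |w|) * |x|) ^ k / k.factorial * ‖g x‖)
      (fun k => ((hpi (X ^ k)).const_mul _).aestronglyMeasurable) ?_ ?_ ?_ ?_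
    · have h0 : (fun k : ℕ => ∫ x : ℝ, ((-2 * Real.pi * w * Complex.I) ^ k / k.factorial) *
        ((((X ^ k : ℝ[X]).eval x : ℝ) : ℂ) * g x)) = fun _ => 0 := by
        funext k; rw [integral_const_mul, hp, mul_zero]
      rw [h0] at key
      exact key.unique hasSum_zero
    · intro k
      refine Filter.Eventually.of_forall fun x => le_of_eq ?_
      simp [mul_pow, abs_of_pos Real.pi_pos]
      ring
    · exact Filter.Eventually.of_forall fun x =>
        (Real.summable_pow_div_factorial _).mul_right _
    · refine (hexp (2 * Real.pi * |w|)).congr (Filter.Eventually.of_forall fun x => ?_)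
      simp only []
      rw [tsum_mul_right, Real.exp_eq_exp_ℝ, NormedSpace.exp_eq_tsum_div]
    · refine Filter.Eventually.of_forall fun x => ?_
      have h1 := NormedSpace.expSeries_div_hasSum_exp
        (((-2 * Real.pi * x * w : ℝ) : ℂ) * Complex.I)
      rw [← Complex.exp_eq_exp_ℂ] at h1
      rw [smul_eq_mul]
      have h2 := h1.mul_right (g x)
      have e : (fun k : ℕ => ((-2 * Real.pi * w * Complex.I) ^ k / k.factorial) *
          ((((X ^ k : ℝ[X]).eval x : ℝ) : ℂ) * g x)) = fun k : ℕ =>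
          (((-2 * Real.pi * x * w : ℝ) : ℂ) * Complex.I) ^ k / k.factorial * g x := by
        funext k
        simp only [eval_pow, eval_X]
        push_cast
        rw [show (-2 * (Real.pi : ℂ) * x * w * Complex.I)
          = (-2 * Real.pi * w * Complex.I) * x by ring, mul_pow (-2 * Real.pi * w * Complex.I)]
        ring
      rw [e]
      exact h2
  have hz := ae_eq_zero_of_fourier_eq_zero hg hF
  rw [Lp.eq_zero_iff_ae_eq_zero]
  filter_upwards [hz] with x hx
  have : (Real.exp (-x ^ 2 / 2) : ℂ) ≠ 0 := by exact_mod_cast (Real.exp_pos _).ne'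
  simpa [hgdef, this] using hx

end Completeness

/-- The number basis `(h_n)` of `L²(ℝ)`. -/
noncomputable def numberBasis : HilbertBasis ℕ ℂ L2R :=
  HilbertBasis.mkOfOrthogonalEqBot orthonormal_numberState (by
    rw [Submodule.eq_bot_iff]
    intro f hf
    refine eq_zero_of_inner_numberState f fun n => ?_
    exact (Submodule.mem_orthogonal _ f).mp hf _ (Submodule.subset_span ⟨n, rfl⟩))

lemma numberBasis_apply (n : ℕ) : numberBasis n = numberState n := by
  simp [numberBasis]

/-! ### The representation `V(θ) = e^{iθN}` -/

/-- The vectors `e^{iθn} h_n`. -/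
noncomputable def rotatedState (θ : ℝ) (n : ℕ) : L2R :=
  Complex.exp (Complex.I * θ * n) • numberBasis n

lemma norm_phase (θ : ℝ) (n : ℕ) : ‖Complex.exp (Complex.I * θ * n)‖ = 1 := by
  rw [show Complex.I * θ * n = ((θ * n : ℝ) : ℂ) * Complex.I by push_cast; ring]
  exact Complex.norm_exp_ofReal_mul_I _

lemma orthonormal_rotatedState (θ : ℝ) : Orthonormal ℂ (rotatedState θ) := by
  refine ⟨fun n => ?_, fun m n hmn => ?_⟩
  · rw [rotatedState, norm_smul, norm_phase, numberBasis.orthonormal.1, one_mul]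
  · simp only [rotatedState]
    rw [inner_smul_left, inner_smul_right, numberBasis.orthonormal.2 hmn, mul_zero, mul_zero]

/-- The Hilbert basis `(e^{iθn} h_n)`. -/
noncomputable def rotatedBasis (θ : ℝ) : HilbertBasis ℕ ℂ L2R :=
  HilbertBasis.mkOfOrthogonalEqBot (orthonormal_rotatedState θ) (by
    rw [Submodule.eq_bot_iff]
    intro f hf
    refine eq_zero_of_inner_numberState f fun n => ?_
    have h := (Submodule.mem_orthogonal _ f).mp hf _ (Submodule.subset_span ⟨n, rfl⟩)
    rw [rotatedState, inner_smul_left] at h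
    rw [← numberBasis_apply]
    refine (mul_eq_zero.mp h).resolve_left ?_
    exact (map_ne_zero (starRingEnd ℂ)).mpr (Complex.exp_ne_zero _))

/-- The unitary operator `V(θ) = e^{iθN}` on `L²(ℝ)`, `N` being the number operator: the unitary
operator with `V(θ) h_n = e^{iθn} h_n` for all `n` (see `numberRot_numberBasis`; recall that
`N h_n = n h_n`, see `numberDiffOp_hermiteFun`). -/
noncomputable def numberRot (θ : ℝ) : L2R ≃ₗᵢ[ℂ] L2R :=
  numberBasis.repr.trans (rotatedBasis θ).repr.symm

theorem numberRot_numberBasis (θ : ℝ) (n : ℕ) :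
    numberRot θ (numberBasis n) = Complex.exp (Complex.I * θ * n) • numberBasis n := by
  simp only [numberRot, LinearIsometryEquiv.trans_apply, HilbertBasis.repr_self,
    HilbertBasis.repr_symm_single]
  simp [rotatedBasis, rotatedState]

/-! ### Multiplication, translation and Weyl operators -/

open Classical in
/-- The operator on `L²(ℝ)` of multiplication by an (essentially) bounded measurable function `φ`;
it is set to `0` for other `φ`. -/
noncomputable def mulOp (φ : ℝ → ℂ) : L2R →L[ℂ] L2R :=
  if h : MemLp φ ⊤ volume then
    (ContinuousLinearMap.mul ℂ ℂ).holderL volume ⊤ 2 2 (h.toLp φ)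
  else 0

theorem mulOp_ae {φ : ℝ → ℂ} (h : MemLp φ ⊤ volume) (f : L2R) :
    mulOp φ f =ᵐ[volume] fun x => φ x * f x := by
  rw [mulOp, dif_pos h]
  refine ((ContinuousLinearMap.mul ℂ ℂ).coeFn_holder (r := 2) (h.toLp φ) f).trans ?_
  filter_upwards [h.coeFn_toLp] with x hx
  simp [hx]

/-- The operator `f ↦ f(· + y)` on `L²(ℝ)`. -/
noncomputable def translationOp (y : ℝ) : L2R →L[ℂ] L2R :=
  (Lp.compMeasurePreservingₗᵢ ℂ (fun z : ℝ => z + y)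
    (measurePreserving_add_right volume y)).toContinuousLinearMap

/-- The unitary Weyl operator `e^{i(xX + yP)}` on `L²(ℝ)`, given by
`[e^{i(xX + yP)} f](z) = e^{i(xy/2 + xz)} f(z + y)`. -/
noncomputable def weylOp (x y : ℝ) : L2R →L[ℂ] L2R :=
  mulOp (fun z => Complex.exp (Complex.I * (x * y / 2 + x * z))) ∘L translationOp y

theorem weylOp_ae (x y : ℝ) (f : L2R) :
    weylOp x y f =ᵐ[volume]
      fun z => Complex.exp (Complex.I * (x * y / 2 + x * z)) * f (z + y) := by
  have hφ : MemLp (fun z : ℝ => Complex.exp (Complex.I * (x * y / 2 + x * z))) ⊤ volume := by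
    refine memLp_top_of_bound (by fun_prop) 1 (Filter.Eventually.of_forall fun z => ?_)
    rw [show Complex.I * (x * y / 2 + x * z) = ((x * y / 2 + x * z : ℝ) : ℂ) * Complex.I by
      push_cast; ring]
    exact (Complex.norm_exp_ofReal_mul_I _).le
  refine (mulOp_ae hφ (translationOp y f)).trans ?_
  filter_upwards [Lp.coeFn_compMeasurePreserving f (measurePreserving_add_right volume y)] with z hz
  rw [show translationOp y f z = f (z + y) from hz]

/-- The position projection `Π(A)`: multiplication by the indicator function of the Borel
set `A`. -/
noncomputable def posProj (A : Set ℝ) : L2R →L[ℂ] L2R :=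
  mulOp (A.indicator 1)

theorem posProj_ae {A : Set ℝ} (hA : MeasurableSet A) (f : L2R) :
    posProj A f =ᵐ[volume] A.indicator f := by
  have hφ : MemLp (A.indicator (1 : ℝ → ℂ)) ⊤ volume := by
    refine memLp_top_of_bound ((measurable_one.indicator hA).aestronglyMeasurable) 1
      (Filter.Eventually.of_forall fun z => ?_)
    by_cases hz : z ∈ A <;> simp [hz]
  refine (mulOp_ae hφ f).trans (Filter.Eventually.of_forall fun z => ?_)
  by_cases hz : z ∈ A <;> simp [hz]

/-- The spectral projection `Π_θ(A) = V(θ) Π(A) V(θ)*` of the quadrature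
`X_θ = V(θ) X V(θ)* = cos θ X + sin θ P`. -/
noncomputable def quadProj (θ : ℝ) (A : Set ℝ) : L2R →L[ℂ] L2R :=
  (numberRot θ : L2R →L[ℂ] L2R) ∘L posProj A ∘L
    ContinuousLinearMap.adjoint (numberRot θ : L2R →L[ℂ] L2R)

/-! ### States and traces -/

/-- The trace `∑ₙ ⟪h_n, T h_n⟫` of an operator on `L²(ℝ)`. For trace class `T` the sum converges
absolutely and does not depend on the Hilbert basis used. -/
noncomputable def opTrace (T : L2R →L[ℂ] L2R) : ℂ :=
  ∑' n, inner ℂ (numberBasis n) (T (numberBasis n))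

/-- States: positive operators of trace one. For a positive operator, convergence of the sum
defining the trace in one Hilbert basis is the same as being trace class. -/
structure IsState (ρ : L2R →L[ℂ] L2R) : Prop where
  isPositive : ρ.IsPositive
  hasSum_trace : HasSum (fun n => inner ℂ (numberBasis n) (ρ (numberBasis n))) 1

/-! ### The homodyne probability distribution and its density -/

/-- `ν^ρ_θ(A) = tr(ρ Π_θ(A))`: the probability that the quadrature `X_θ` measured on the state `ρ`
has its value in `A`. -/
noncomputable def quadProb (ρ : L2R →L[ℂ] L2R) (θ : ℝ) (A : Set ℝ) : ℂ :=
  opTrace (ρ ∘L quadProj θ A)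

/-- The uniform probability distribution `dθ/2π` on `[0, 2π]`. -/
noncomputable def phaseMeasure : Measure ℝ :=
  ENNReal.ofReal (1 / (2 * Real.pi)) • volume.restrict (Set.Icc 0 (2 * Real.pi))

/-- The measure `dθ/2π dx` on `[0, 2π] × ℝ`. -/
noncomputable def phaseSpaceMeasure : Measure (ℝ × ℝ) := phaseMeasure.prod volume

/-- The homodyne probability `μ^ρ(B) = ∫ ν^ρ_θ(B^θ) dθ/2π` of a Borel set `B ⊆ [0, 2π] × ℝ`,
`B^θ = {x | (θ, x) ∈ B}` being the section of `B` at `θ`. -/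
noncomputable def homodyneProb (ρ : L2R →L[ℂ] L2R) (B : Set (ℝ × ℝ)) : ℂ :=
  ∫ θ, quadProb ρ θ {x | (θ, x) ∈ B} ∂phaseMeasure

/-- `p` is (a representative of) the homodyne density `p^ρ`, i.e. the density of `μ^ρ` with
respect to `dθ/2π dx`. -/
structure IsHomodyneDensity (ρ : L2R →L[ℂ] L2R) (p : ℝ × ℝ → ℝ) : Prop where
  integrable : Integrable p phaseSpaceMeasure
  /-- the integral defining `μ^ρ(B)` exists -/
  integrable_section : ∀ B : Set (ℝ × ℝ), MeasurableSet B →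
    Integrable (fun θ => quadProb ρ θ {x | (θ, x) ∈ B}) phaseMeasure
  homodyneProb_eq : ∀ B : Set (ℝ × ℝ), MeasurableSet B →
    homodyneProb ρ B = ((∫ z in B, p z ∂phaseSpaceMeasure : ℝ) : ℂ)

/-! ### The Wigner function and the Radon transform -/

/-- The plane `ℝ²`. -/
abbrev Plane : Type := EuclideanSpace ℝ (Fin 2)

/-- The Hilbert space `L²(ℝ²)`. -/
abbrev L2Plane : Type := Lp (α := Plane) ℂ 2

/-- The function `V(ρ)(x, y) = (2π)^{-1/2} tr(ρ e^{i(xX + yP)})`. -/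
noncomputable def weylTransform (ρ : L2R →L[ℂ] L2R) (q : Plane) : ℂ :=
  (1 / Real.sqrt (2 * Real.pi) : ℝ) * opTrace (ρ ∘L weylOp (q 0) (q 1))

open FourierTransform in
/-- The unitary Fourier transform `F₂` of `L²(ℝ²)`, normalized so that
`F₂ u(ξ) = (2π)⁻¹ ∫ e^{-i ξ·q} u(q) dq` for `u ∈ L¹ ∩ L²`. Mathlib's transform `𝓕` has the kernel
`e^{-2πi ξ·q}`, whence `F₂ u(ξ) = (2π)⁻¹ (𝓕 u)(ξ/2π)`. -/
noncomputable def fourierPlane (u : L2Plane) (ξ : Plane) : ℂ :=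
  (1 / (2 * Real.pi) : ℝ) * (𝓕 u : L2Plane) ((1 / (2 * Real.pi) : ℝ) • ξ)

open Classical in
/-- The Wigner function `W(ρ) = (2π)^{-1/2} F₂ V(ρ)`, an `L²` function on the plane. (The
condition `V(ρ) ∈ L²(ℝ²)` holds for every state.) -/
noncomputable def wigner (ρ : L2R →L[ℂ] L2R) : Plane → ℂ :=
  if h : MemLp (weylTransform ρ) 2 volume then
    fun ξ => (1 / Real.sqrt (2 * Real.pi) : ℝ) * fourierPlane (h.toLp (weylTransform ρ)) ξ
  else 0

/-- The point with coordinate `r` along `(cos θ, sin θ)` and `t` along `(-sin θ, cos θ)`. -/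
noncomputable def linePoint (θ r t : ℝ) : Plane :=
  !₂[r * Real.cos θ - t * Real.sin θ, r * Real.sin θ + t * Real.cos θ]

/-- The Radon transform
`Rf(θ, r) = ∫ f(r cos θ - t sin θ, r sin θ + t cos θ) dt`. -/
noncomputable def radon (f : Plane → ℂ) (θ r : ℝ) : ℂ :=
  ∫ t, f (linePoint θ r t)

end Homodyne

/-! ### Radon transform of the Wigner function

The Fourier transform in `r` of both sides, at fixed phase `θ`, is the function
`s ↦ tr(ρ e^{is(cos θ X + sin θ P)})`.

On the side of the Radon transform this is the Fourier slice theorem (`integral_exp_mul_radon`)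
together with Fourier inversion: `W(ρ)` is, up to normalization, the Fourier transform of `V(ρ)` in
`L²`, so if it is integrable then its inverse transform is given by an integral and equals `V(ρ)`
(`IsState.opTrace_weylOp_eq_integral_wigner`). Equality holds at every point, since `V(ρ)` is
continuous (`IsState.continuous_weylTransform`).

On the side of the homodyne measure it is the covariance
`e^{ir(cos θ X + sin θ P)} = V(θ) e^{irX} V(θ)*` (`weylOp_polar`), which turns the trace into the
characteristic function of the distribution of the quadrature `X_θ` (`opTrace_weylOp_polar`). The
covariance is checked on the coherent states `G_a = ∑ aⁿ/√n! h_n`, which form a total set: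
`V(θ)` rotates the parameter `a`, and Weyl operators translate it, up to explicit scalars.

Traces are handled by writing `ρ` as a mixture of vector states
(`IsState.exists_decomposition`). It shows that `V(ρ) ∈ L²`, as Plancherel's theorem bounds the
contribution of each vector state, and it presents the quadrature distributions as a Markov kernel
in `θ` with values absolutely continuous with respect to Lebesgue measure, so that the
homodyne density exists by the Radon–Nikodym theorem (`IsState.exists_isHomodyneDensity`). By
uniqueness of Fourier transforms, the Radon transform of `W(ρ)` has the integrals over Borel sets
that characterize the density.
-/

namespace Homodyne

/-! ### The Fourier transform on `L¹ ∩ L²` -/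

lemma eLpNorm_two_sq {α E : Type*} [MeasurableSpace α] [NormedAddCommGroup E] {μ : Measure α}
    (f : α → E) : eLpNorm f 2 μ ^ 2 = ∫⁻ x, ‖f x‖ₑ ^ 2 ∂μ := by
  have e := eLpNorm_nnreal_pow_eq_lintegral (p := 2) (μ := μ) (f := f) two_ne_zero
  simpa only [NNReal.coe_ofNat, ENNReal.coe_ofNat, ENNReal.rpow_ofNat] using e

section Fourier
open FourierTransform SchwartzMap
open scoped ENNReal

variable {E : Type*} [NormedAddCommGroup E] [InnerProductSpace ℝ E] [FiniteDimensional ℝ E]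
  [MeasurableSpace E] [BorelSpace E]

lemma continuous_fourierInv {f : E → ℂ} (hf : Integrable f) : Continuous (𝓕⁻ f) := by
  rw [Real.fourierInv_eq_fourier_comp_neg]
  exact VectorFourier.fourierIntegral_continuous Real.continuous_fourierChar continuous_inner
    hf.comp_neg

/-- On `L¹ ∩ L²` the inverse Fourier transform of `L²`, which is defined by continuity, is given by
the integral: both define the same tempered distribution. -/
lemma fourierInv_toLp_ae {f : E → ℂ} (h1 : Integrable f) (h2 : MemLp f 2) :
    (𝓕⁻ (h2.toLp f) : Lp (α := E) ℂ 2) =ᵐ[volume] 𝓕⁻ f := by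
  have hcont := continuous_fourierInv h1
  refine ae_eq_of_integral_contDiff_smul_eq ?_ hcont.locallyIntegrable ?_
  · exact (Lp.memLp _).locallyIntegrable (by norm_num)
  intro u u_smooth u_cpt
  have hu₁ : HasCompactSupport (Complex.ofRealCLM ∘ u) := u_cpt.comp_left rfl
  have hu₂ : ContDiff ℝ ((⊤ : ℕ∞) : WithTop ℕ∞) (Complex.ofRealCLM ∘ u) := by fun_prop
  set ψ : SchwartzMap E ℂ := hu₁.toSchwartzMap hu₂ with hψ
  have hψx (x : E) : ψ x = (u x : ℂ) := by simp [hψ]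
  have h3 := congrArg (fun T => T ψ) (Lp.fourierInv_toTemperedDistribution_eq (h2.toLp f))
  simp only [TemperedDistribution.fourierInv_apply, Lp.toTemperedDistribution_apply] at h3
  have hneg : Continuous fun p : E × E => (-innerₗ E) p.1 p.2 := by
    simp only [LinearMap.neg_apply, innerₗ_apply_apply]; fun_prop
  have h4 := VectorFourier.integral_fourierIntegral_smul_eq_flip (L := -innerₗ E)
    Real.continuous_fourierChar hneg (ψ.integrable (μ := volume)) h1
  have hfl : (-innerₗ E).flip = -innerₗ E := by
    ext x y; simp [real_inner_comm]
  rw [hfl] at h4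
  change ∫ x, 𝓕⁻ (⇑ψ) x • f x = ∫ x, ψ x • 𝓕⁻ f x at h4
  rw [← SchwartzMap.fourierInv_coe] at h4
  have h5 : ∫ x, (𝓕⁻ ψ) x • (h2.toLp f) x = ∫ x, (𝓕⁻ ψ) x • f x := by
    refine integral_congr_ae ?_
    filter_upwards [h2.coeFn_toLp] with x hx
    rw [hx]
  rw [h5, h4] at h3
  simp only [hψx] at h3
  simpa using h3.symm

/-- Plancherel's theorem for integrable square integrable functions. -/
lemma lintegral_enorm_fourierInv_sq {f : E → ℂ} (h1 : Integrable f) (h2 : MemLp f 2) :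
    ∫⁻ w, ‖𝓕⁻ f w‖ₑ ^ 2 = ∫⁻ x, ‖f x‖ₑ ^ 2 := by
  have h : eLpNorm (𝓕⁻ f) 2 volume = eLpNorm f 2 volume := by
    rw [← eLpNorm_congr_ae (fourierInv_toLp_ae h1 h2), ← eLpNorm_congr_ae h2.coeFn_toLp]
    have := Lp.norm_fourier_eq (𝓕⁻ (h2.toLp f))
    rw [fourier_fourierInv_eq] at this
    have := this.symm
    rwa [Lp.norm_def, Lp.norm_def, ENNReal.toReal_eq_toReal_iff' (Lp.eLpNorm_ne_top _)
      (Lp.eLpNorm_ne_top _)] at this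
  rw [← eLpNorm_two_sq, ← eLpNorm_two_sq, h]

end Fourier

/-! ### Coherent states -/

section Coherent

/-- The normalised generating function of the Hermite functions,
`G_a(z) = π^{-1/4} exp(-z²/2 + √2 a z - a²/2) = ∑ aⁿ/√n! h_n(z)`. -/
noncomputable def coherentFun (a : ℂ) (z : ℝ) : ℂ :=
  ((Real.sqrt (Real.sqrt Real.pi))⁻¹ : ℝ) *
    Complex.exp (-(z : ℂ) ^ 2 / 2 + Real.sqrt 2 * a * z - a ^ 2 / 2)

lemma memLp_coherentFun (a : ℂ) : MemLp (coherentFun a) 2 := by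
  refine (memLp_exp_abs_gauss (Real.sqrt 2 * ‖a‖)).of_le_mul
    (c := (Real.sqrt (Real.sqrt Real.pi))⁻¹ * Real.exp (‖a‖ ^ 2 / 2))
    (by unfold coherentFun; fun_prop) (Filter.Eventually.of_forall fun z => ?_)
  rw [coherentFun, norm_mul, Complex.norm_real, Real.norm_of_nonneg (by positivity),
    Complex.norm_exp, Real.norm_of_nonneg (by positivity), mul_assoc (Real.sqrt _)⁻¹, ← Real.exp_add]
  gcongr
  have e1 : (Real.sqrt 2 * a * z : ℂ).re ≤ Real.sqrt 2 * ‖a‖ * |z| := by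
    refine (Complex.re_le_norm _).trans (le_of_eq ?_)
    simp [abs_of_nonneg (Real.sqrt_nonneg 2)]
  have e2 : -(a ^ 2 / 2 : ℂ).re ≤ ‖a‖ ^ 2 / 2 := by
    refine (neg_le_abs _).trans ((Complex.abs_re_le_norm _).trans (le_of_eq ?_))
    simp
  have e3 : (-(z : ℂ) ^ 2 / 2).re = -z ^ 2 / 2 := by
    rw [show (-(z : ℂ) ^ 2 / 2) = ((-z ^ 2 / 2 : ℝ) : ℂ) by push_cast; ring, Complex.ofReal_re]
  rw [Complex.sub_re, Complex.add_re, e3]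
  linarith

/-- The coherent state `G_a` as a vector of `L²(ℝ)`. -/
noncomputable def coherentState (a : ℂ) : L2R := (memLp_coherentFun a).toLp

section
open Polynomial

lemma integrable_poly_gauss_mul_exp (p : ℝ[X]) (a : ℂ) :
    Integrable fun z : ℝ => ((p.eval z : ℝ) : ℂ) *
      Complex.exp (-(z : ℂ) ^ 2 + Real.sqrt 2 * a * z - a ^ 2 / 2) := by
  have h : Integrable fun z : ℝ => ((p.eval z * Real.exp (-z ^ 2 / 2) : ℝ) : ℂ) * coherentFun a z :=
    (memLp_poly_gauss p).ofReal (K := ℂ) |>.integrable_mul (memLp_coherentFun a)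
  refine (h.const_mul ((Real.sqrt (Real.sqrt Real.pi) : ℝ) : ℂ)).congr
    (Filter.Eventually.of_forall fun z => ?_)
  have h0 : ((Real.sqrt (Real.sqrt Real.pi) : ℝ) : ℂ) ≠ 0 := by
    exact_mod_cast (by positivity : Real.sqrt (Real.sqrt Real.pi) ≠ 0)
  simp only [coherentFun]
  push_cast
  rw [show -(z : ℂ) ^ 2 + Real.sqrt 2 * a * z - a ^ 2 / 2
    = -(z : ℂ) ^ 2 / 2 + (-(z : ℂ) ^ 2 / 2 + Real.sqrt 2 * a * z - a ^ 2 / 2) by ring, Complex.exp_add]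
  field_simp

/-- The induction step integrates the derivative of `P_n(z) exp(-z² + √2 a z - a²/2)`, where
`P_n` is `hermitePoly n`. -/
lemma integral_hermitePoly_mul_exp (n : ℕ) (a : ℂ) :
    ∫ z : ℝ, (((hermitePoly n).eval z : ℝ) : ℂ) *
      Complex.exp (-(z : ℂ) ^ 2 + Real.sqrt 2 * a * z - a ^ 2 / 2) = a ^ n * Real.sqrt Real.pi := by
  have h2 : ((Real.sqrt 2 : ℝ) : ℂ) ^ 2 = 2 := by
    rw [← Complex.ofReal_pow, Real.sq_sqrt (by norm_num)]; simp
  have h20 : ((Real.sqrt 2 : ℝ) : ℂ) ≠ 0 := by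
    exact_mod_cast (by positivity : Real.sqrt 2 ≠ 0)
  induction n with
  | zero =>
    have h := integral_cexp_quadratic (b := -1) (by simp) (Real.sqrt 2 * a) (-(a ^ 2 / 2))
    simp only [hermitePoly, hermite_zero, map_one, one_comp, Polynomial.map_one, eval_one,
      Complex.ofReal_one, one_mul, pow_zero]
    convert h using 1
    · congr 1; funext z; congr 1; ring
    · have e : -(a ^ 2 / 2) - (Real.sqrt 2 * a) ^ 2 / (4 * (-1 : ℂ)) = 0 := by
        rw [mul_pow, h2]; ring
      rw [e, Complex.exp_zero, mul_one, Real.sqrt_eq_rpow, Complex.ofReal_cpow Real.pi_pos.le]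
      simp
  | succ n ih =>
    set e : ℝ → ℂ := fun z => Complex.exp (-(z : ℂ) ^ 2 + Real.sqrt 2 * a * z - a ^ 2 / 2) with he
    have hI (p : ℝ[X]) : Integrable fun z : ℝ => ((p.eval z : ℝ) : ℂ) * e z :=
      integrable_poly_gauss_mul_exp p a
    have hd (z : ℝ) : HasDerivAt (fun z : ℝ => (((hermitePoly n).eval z : ℝ) : ℂ) * e z)
        (Real.sqrt 2 * a * ((((hermitePoly n).eval z : ℝ) : ℂ) * e z)
          - Real.sqrt 2 * ((((hermitePoly (n + 1)).eval z : ℝ) : ℂ) * e z)) z := by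
      have h1 : HasDerivAt (fun z : ℂ => -z ^ 2 + Real.sqrt 2 * a * z - a ^ 2 / 2)
          (-(2 * z) + Real.sqrt 2 * a) (z : ℂ) := by
        refine (((hasDerivAt_pow 2 (z : ℂ)).neg.add
          ((hasDerivAt_id (z : ℂ)).const_mul (Real.sqrt 2 * a))).sub_const _).congr_deriv ?_
        simp
      have h3 : HasDerivAt e _ z := h1.cexp.comp_ofReal
      refine (((hermitePoly n).hasDerivAt z).ofReal_comp.mul h3).congr_deriv ?_
      have := congrArg (eval z) (hermitePoly_succ n)
      simp only [eval_mul, eval_C, eval_sub, eval_X, eval_ofNat] at this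
      have := congrArg (fun t : ℝ => (t : ℂ)) this
      simp only [he]
      push_cast at this ⊢
      linear_combination (Complex.exp (-(z : ℂ) ^ 2 + Real.sqrt 2 * a * z - a ^ 2 / 2)) * this
    have key := integral_eq_zero_of_hasDerivAt_of_integrable hd
      (((hI _).const_mul _).sub ((hI _).const_mul _)) (hI _)
    rw [integral_sub ((hI _).const_mul _) ((hI _).const_mul _), integral_const_mul,
      integral_const_mul, ih] at key
    apply mul_left_cancel₀ h20
    linear_combination -key

end

/-- The coefficients of a coherent state in the number basis. -/
lemma inner_numberBasis_coherentState (n : ℕ) (a : ℂ) :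
    inner ℂ (numberBasis n) (coherentState a) = a ^ n / Real.sqrt n.factorial := by
  have h1 : inner ℂ (numberBasis n) (coherentState a) =
      ∫ z : ℝ, (((Real.sqrt (Real.sqrt Real.pi))⁻¹ *
        (Real.sqrt ((n.factorial : ℝ) * Real.sqrt Real.pi))⁻¹ : ℝ) : ℂ) *
        ((((hermitePoly n).eval z : ℝ) : ℂ) *
        Complex.exp (-(z : ℂ) ^ 2 + Real.sqrt 2 * a * z - a ^ 2 / 2)) := by
    rw [numberBasis_apply, L2.inner_def]
    refine integral_congr_ae ?_
    filter_upwards [(memLp_hermiteFun n).coeFn_toLp, (memLp_coherentFun a).coeFn_toLp] with z h1 h2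
    rw [numberState, coherentState, h1, h2]
    simp only [coherentFun, hermiteFun, RCLike.inner_apply, Complex.conj_ofReal]
    rw [show -(z : ℂ) ^ 2 + Real.sqrt 2 * a * z - a ^ 2 / 2
      = -(z : ℂ) ^ 2 / 2 + (-(z : ℂ) ^ 2 / 2 + Real.sqrt 2 * a * z - a ^ 2 / 2) by ring,
      Complex.exp_add]
    push_cast
    ring
  rw [h1, integral_const_mul, integral_hermitePoly_mul_exp]
  have h2 : (Real.sqrt (Real.sqrt Real.pi))⁻¹ *
        (Real.sqrt ((n.factorial : ℝ) * Real.sqrt Real.pi))⁻¹ * Real.sqrt Real.pi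
        = (Real.sqrt n.factorial)⁻¹ := by
    rw [Real.sqrt_mul (by positivity)]
    have : Real.sqrt Real.pi = Real.sqrt (Real.sqrt Real.pi) * Real.sqrt (Real.sqrt Real.pi) :=
      (Real.mul_self_sqrt (Real.sqrt_nonneg _)).symm
    have h0 : Real.sqrt (Real.sqrt Real.pi) ≠ 0 := by positivity
    rw [mul_inv]
    nth_rewrite 3 [this]
    field_simp
  have h3 := congrArg (fun t : ℝ => (t : ℂ)) h2
  push_cast at h3 ⊢
  linear_combination a ^ n * h3

/-- Parseval's identity in the number basis gives an exponential series. -/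
lemma inner_coherentState (a b : ℂ) :
    inner ℂ (coherentState b) (coherentState a) = Complex.exp (starRingEnd ℂ b * a) := by
  have h := numberBasis.hasSum_inner_mul_inner (coherentState b) (coherentState a)
  refine h.unique ?_
  have h1 := NormedSpace.expSeries_div_hasSum_exp (starRingEnd ℂ b * a)
  rw [← Complex.exp_eq_exp_ℂ] at h1
  convert h1 using 1
  funext n
  rw [inner_numberBasis_coherentState, ← inner_conj_symm, inner_numberBasis_coherentState]
  have h2 : ((Real.sqrt n.factorial : ℝ) : ℂ) * ((Real.sqrt n.factorial : ℝ) : ℂ) = n.factorial := by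
    rw [← Complex.ofReal_mul, Real.mul_self_sqrt (by positivity)]; simp
  rw [map_div₀, map_pow, Complex.conj_ofReal, div_mul_div_comm, h2, mul_pow]

/-- Norm continuity follows from the continuity of the inner products `⟪G_b, G_a⟫ = exp(b̄ a)`. -/
lemma continuous_coherentState : Continuous coherentState := by
  rw [continuous_iff_continuousAt]
  intro b
  rw [ContinuousAt, tendsto_iff_norm_sub_tendsto_zero]
  have h (a : ℂ) : ‖coherentState a - coherentState b‖ ^ 2 =
      (Complex.exp (starRingEnd ℂ a * a)).re - 2 * (Complex.exp (starRingEnd ℂ a * b)).re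
        + (Complex.exp (starRingEnd ℂ b * b)).re := by
    rw [@norm_sub_sq ℂ, ← inner_coherentState, ← inner_coherentState, ← inner_coherentState,
      inner_self_eq_norm_sq_to_K, inner_self_eq_norm_sq_to_K]
    norm_cast
  have h2 : Filter.Tendsto (fun a => ‖coherentState a - coherentState b‖ ^ 2) (nhds b) (nhds 0) := by
    simp only [h]
    have hc : Continuous fun a : ℂ => (Complex.exp (starRingEnd ℂ a * a)).re
        - 2 * (Complex.exp (starRingEnd ℂ a * b)).re + (Complex.exp (starRingEnd ℂ b * b)).re := by
      fun_prop
    convert hc.tendsto b using 2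
    ring
  simpa using h2.sqrt

/-- The coherent states are total: already for imaginary `a` the products `⟪G_a, f⟫` are, up to
constants, the values of the Fourier transform of `e^{-x²/2} f(x)`. -/
lemma eq_zero_of_inner_coherentState (f : L2R) (hf : ∀ a, inner ℂ (coherentState a) f = 0) :
    f = 0 := by
  set g : ℝ → ℂ := fun x => (Real.exp (-x ^ 2 / 2) : ℂ) * f x with hgdef
  have hg : Integrable g := by
    have := (memLp_poly_gauss 1).ofReal (K := ℂ) |>.integrable_mul (Lp.memLp f)
    refine this.congr (Filter.Eventually.of_forall fun x => ?_)
    simp [hgdef]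
  have hF (w : ℝ) : FourierTransform.fourier g w = 0 := by
    rw [Real.fourier_real_eq_integral_exp_smul]
    have h1 := hf (Complex.I * (Real.sqrt 2 * Real.pi * w : ℝ))
    rw [L2.inner_def] at h1
    have h2 : ∫ z, (((Real.sqrt (Real.sqrt Real.pi))⁻¹ *
        Real.exp ((Real.sqrt 2 * Real.pi * w) ^ 2 / 2) : ℝ) : ℂ) *
        (Complex.exp (((-2 * Real.pi * z * w : ℝ) : ℂ) * Complex.I) • g z) = 0 := by
      rw [← h1]
      refine integral_congr_ae ?_
      filter_upwards [(memLp_coherentFun (Complex.I * (Real.sqrt 2 * Real.pi * w : ℝ))).coeFn_toLp]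
        with z hz
      rw [coherentState, hz]
      simp only [hgdef, coherentFun, RCLike.inner_apply, map_mul, Complex.conj_ofReal,
        ← Complex.exp_conj, smul_eq_mul]
      have h2 : ((Real.sqrt 2 : ℝ) : ℂ) ^ 2 = 2 := by
        rw [← Complex.ofReal_pow, Real.sq_sqrt (by norm_num)]; simp
      have e : (starRingEnd ℂ) (-(z : ℂ) ^ 2 / 2 + Real.sqrt 2 *
          (Complex.I * (Real.sqrt 2 * Real.pi * w : ℝ)) * z -
          (Complex.I * (Real.sqrt 2 * Real.pi * w : ℝ)) ^ 2 / 2)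
          = (((Real.sqrt 2 * Real.pi * w) ^ 2 / 2 : ℝ) : ℂ)
            + (((-2 * Real.pi * z * w : ℝ) : ℂ) * Complex.I + ((-z ^ 2 / 2 : ℝ) : ℂ)) := by
        simp only [map_sub, map_add, map_div₀, map_mul, map_pow, map_neg, Complex.conj_ofReal,
          Complex.conj_I, map_ofNat]
        push_cast
        linear_combination (-(Complex.I * Real.pi * w * z)) * h2 -
          ((Real.sqrt 2 : ℝ) * Real.pi * w) ^ 2 / 2 * Complex.I_sq
      rw [e, Complex.exp_add, Complex.exp_add]
      push_cast
      ring
    rw [integral_const_mul] at h2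
    refine (mul_eq_zero.mp h2).resolve_left ?_
    exact_mod_cast (by positivity : (Real.sqrt (Real.sqrt Real.pi))⁻¹ *
        Real.exp ((Real.sqrt 2 * Real.pi * w) ^ 2 / 2) ≠ 0)
  rw [Lp.eq_zero_iff_ae_eq_zero]
  filter_upwards [ae_eq_zero_of_fourier_eq_zero hg hF] with x hx
  have : (Real.exp (-x ^ 2 / 2) : ℂ) ≠ 0 := by exact_mod_cast (Real.exp_pos _).ne'
  simpa [hgdef, this] using hx

lemma clm_ext_coherentState {A B : L2R →L[ℂ] L2R}
    (h : ∀ a, A (coherentState a) = B (coherentState a)) : A = B := by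
  rw [← sub_eq_zero, ← ContinuousLinearMap.adjoint.map_eq_zero_iff]
  ext1 g
  refine eq_zero_of_inner_coherentState _ fun a => ?_
  rw [ContinuousLinearMap.adjoint_inner_right]
  simp [h]

lemma dense_span_coherentState :
    Dense (Submodule.span ℂ (Set.range coherentState) : Set L2R) := by
  rw [Submodule.dense_iff_topologicalClosure_eq_top, Submodule.topologicalClosure_eq_top_iff,
    Submodule.eq_bot_iff]
  intro f hf
  refine eq_zero_of_inner_coherentState f fun a => ?_
  exact (Submodule.mem_orthogonal _ f).mp hf _ (Submodule.subset_span ⟨a, rfl⟩)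

end Coherent

/-! ### Phase rotations and Weyl operators -/

section Rotation

lemma inner_numberBasis_numberRot (θ : ℝ) (n : ℕ) (f : L2R) :
    inner ℂ (numberBasis n) (numberRot θ f)
      = Complex.exp (Complex.I * θ * n) * inner ℂ (numberBasis n) f := by
  have h : inner ℂ (numberRot θ (numberBasis n)) (numberRot θ f) = inner ℂ (numberBasis n) f :=
    (numberRot θ).inner_map_map _ _
  rw [numberRot_numberBasis, inner_smul_left] at h
  rw [← h, ← mul_assoc, Complex.mul_conj, Complex.normSq_eq_norm_sq, norm_phase]
  simp

lemma ext_inner_numberBasis {f g : L2R}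
    (h : ∀ n, inner ℂ (numberBasis n) f = inner ℂ (numberBasis n) g) : f = g := by
  rw [← sub_eq_zero]
  refine eq_zero_of_inner_numberState _ fun n => ?_
  rw [← numberBasis_apply, inner_sub_right, h, sub_self]

/-- The operator `V(θ)` rotates the parameter of a coherent state. -/
lemma numberRot_coherentState (θ : ℝ) (a : ℂ) :
    numberRot θ (coherentState a) = coherentState (Complex.exp (Complex.I * θ) * a) := by
  refine ext_inner_numberBasis fun n => ?_
  rw [inner_numberBasis_numberRot, inner_numberBasis_coherentState,
    inner_numberBasis_coherentState, mul_pow, ← Complex.exp_nat_mul, mul_div_assoc]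
  congr 2; ring

lemma adjoint_numberRot (θ : ℝ) :
    ContinuousLinearMap.adjoint (numberRot θ : L2R →L[ℂ] L2R) = (numberRot (-θ) : L2R →L[ℂ] L2R) := by
  ext1 f
  refine ext_inner_numberBasis fun n => ?_
  rw [ContinuousLinearMap.adjoint_inner_right]
  change inner ℂ (numberRot θ (numberBasis n)) f = inner ℂ (numberBasis n) (numberRot (-θ) f)
  rw [inner_numberBasis_numberRot, numberRot_numberBasis, inner_smul_left, ← Complex.exp_conj]
  congr 2; simp

end Rotation

section Weyl

/-- The Weyl operators translate the parameter of a coherent state. -/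
lemma weylOp_coherentState (x y : ℝ) (a : ℂ) :
    weylOp x y (coherentState a) =
      Complex.exp (Complex.I * a * (x - Complex.I * y) / Real.sqrt 2 - ((x : ℂ) ^ 2 + y ^ 2) / 4) •
        coherentState (a + Complex.I * (x + Complex.I * y) / Real.sqrt 2) := by
  have h2 : ((Real.sqrt 2 : ℝ) : ℂ) ^ 2 = 2 := by
    rw [← Complex.ofReal_pow, Real.sq_sqrt (by norm_num)]; simp
  have h20 : ((Real.sqrt 2 : ℝ) : ℂ) ≠ 0 := by
    exact_mod_cast (by positivity : Real.sqrt 2 ≠ 0)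
  apply Lp.ext
  have h1 := (measurePreserving_add_right volume y).quasiMeasurePreserving.ae_eq_comp
    (memLp_coherentFun a).coeFn_toLp
  filter_upwards [weylOp_ae x y (coherentState a), h1,
    (memLp_coherentFun (a + Complex.I * (x + Complex.I * y) / Real.sqrt 2)).coeFn_toLp,
    Lp.coeFn_smul (Complex.exp (Complex.I * a * (x - Complex.I * y) / Real.sqrt 2
      - ((x : ℂ) ^ 2 + y ^ 2) / 4))
        (coherentState (a + Complex.I * (x + Complex.I * y) / Real.sqrt 2))] with z e1 e2 e3 e4
  simp only [Function.comp_apply] at e2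
  rw [e1, e4, Pi.smul_apply, coherentState, coherentState, e2, e3]
  simp only [coherentFun, smul_eq_mul]
  rw [mul_left_comm, mul_left_comm (Complex.exp _), ← Complex.exp_add, ← Complex.exp_add]
  congr 2
  push_cast
  field_simp
  simp only [h2]
  ring_nf
  simp only [Complex.I_sq, h2, show Complex.I ^ 3 = -Complex.I from by simp, Complex.I_pow_four]
  ring

lemma norm_weylOp_apply (x y : ℝ) (f : L2R) : ‖weylOp x y f‖ = ‖f‖ := by
  have h : ‖translationOp y f‖ = ‖f‖ :=
    (Lp.compMeasurePreservingₗᵢ ℂ (fun z : ℝ => z + y)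
      (measurePreserving_add_right volume y)).norm_map f
  rw [← h, Lp.norm_def, Lp.norm_def]
  congr 1
  refine eLpNorm_congr_norm_ae ?_
  filter_upwards [weylOp_ae x y f, Lp.coeFn_compMeasurePreserving f
    (measurePreserving_add_right volume y)] with z h1 h2
  rw [h1, show translationOp y f z = f (z + y) from h2, norm_mul,
    show Complex.I * (x * y / 2 + x * z) = ((x * y / 2 + x * z : ℝ) : ℂ) * Complex.I by
      push_cast; ring, Complex.norm_exp_ofReal_mul_I, one_mul]

/-- The Weyl operators are strongly continuous. -/
lemma continuous_weylOp_apply (f : L2R) : Continuous fun q : ℝ × ℝ => weylOp q.1 q.2 f := by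
  have hs : ∀ g ∈ Submodule.span ℂ (Set.range coherentState),
      Continuous fun q : ℝ × ℝ => weylOp q.1 q.2 g := by
    intro g hg
    induction hg using Submodule.span_induction with
    | mem g hg =>
      obtain ⟨a, rfl⟩ := hg
      simp only [weylOp_coherentState]
      have h1 : Continuous fun q : ℝ × ℝ => Complex.exp (Complex.I * a *
          (q.1 - Complex.I * q.2) / Real.sqrt 2 - ((q.1 : ℂ) ^ 2 + (q.2 : ℂ) ^ 2) / 4) := by fun_prop
      have h2 : Continuous fun q : ℝ × ℝ =>
          a + Complex.I * (q.1 + Complex.I * q.2) / Real.sqrt 2 := by fun_prop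
      exact h1.smul (continuous_coherentState.comp h2)
    | zero => simpa using continuous_const
    | add g h _ _ h1 h2 => simp only [map_add]; exact h1.add h2
    | smul c g _ h1 => simp only [map_smul]; exact h1.const_smul c
  refine continuous_of_uniform_approx_of_continuous fun u hu => ?_
  obtain ⟨ε, hε, hu⟩ := Metric.mem_uniformity_dist.mp hu
  obtain ⟨g, hg, hfg⟩ := Metric.dense_iff.mp dense_span_coherentState f ε hε
  refine ⟨_, hs g hfg, fun q => hu ?_⟩
  rw [dist_eq_norm, ← map_sub, norm_weylOp_apply, ← dist_eq_norm, dist_comm]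
  exact Metric.mem_ball.mp hg

/-- Covariance of the Weyl operators: `e^{ir(cos θ X + sin θ P)} = V(θ) e^{irX} V(θ)*`. -/
lemma weylOp_polar (θ r : ℝ) :
    weylOp (r * Real.cos θ) (r * Real.sin θ) = (numberRot θ : L2R →L[ℂ] L2R) ∘L weylOp r 0 ∘L
      ContinuousLinearMap.adjoint (numberRot θ : L2R →L[ℂ] L2R) := by
  refine clm_ext_coherentState fun a => ?_
  rw [adjoint_numberRot]
  change _ = numberRot θ (weylOp r 0 (numberRot (-θ) (coherentState a)))
  have hE : Complex.exp (Complex.I * θ) = Real.cos θ + Complex.I * Real.sin θ := by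
    rw [mul_comm, Complex.exp_mul_I]; push_cast; ring
  have hE' : Complex.exp (Complex.I * (-θ : ℝ)) = Real.cos θ - Complex.I * Real.sin θ := by
    rw [mul_comm, Complex.exp_mul_I]; push_cast; simp; ring
  have h1 : ((Real.cos θ : ℝ) : ℂ) ^ 2 + ((Real.sin θ : ℝ) : ℂ) ^ 2 = 1 := by
    exact_mod_cast Real.cos_sq_add_sin_sq θ
  rw [numberRot_coherentState, weylOp_coherentState, weylOp_coherentState, map_smul,
    numberRot_coherentState, hE, hE']
  congr 2
  · rw [Complex.ofReal_mul, Complex.ofReal_mul, Complex.ofReal_zero]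
    linear_combination (-(r : ℂ) ^ 2 / 4) * h1
  · rw [Complex.ofReal_mul, Complex.ofReal_mul, Complex.ofReal_zero]
    linear_combination (-a) * h1 - a * ((Real.sin θ : ℝ) : ℂ) ^ 2 * (-1) * (Complex.I_sq)

end Weyl

/-! ### Decomposition of a state into vector states -/

section Trace

variable {H : Type*} [NormedAddCommGroup H] [InnerProductSpace ℂ H]

lemma hasSum_norm_inner_sq (b : HilbertBasis ℕ ℂ H) (f : H) :
    HasSum (fun m => ‖inner ℂ (b m) f‖ ^ 2) (‖f‖ ^ 2) := by
  have h := (b.hasSum_inner_mul_inner f f).mapL Complex.reCLM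
  rw [inner_self_eq_norm_sq_to_K] at h
  convert h using 1
  · funext m
    rw [← inner_conj_symm f, mul_comm, Complex.mul_conj, Complex.normSq_eq_norm_sq]
    rfl
  · norm_cast

variable [CompleteSpace H]

/-- The trace of `T* S`, computed in a Hilbert basis, is cyclic as soon as `T` and `S*` are
Hilbert–Schmidt. -/
lemma exists_hasSum_inner_adjoint (b : HilbertBasis ℕ ℂ H) (T S : H →L[ℂ] H)
    (hT : Summable fun n => ‖T (b n)‖ ^ 2)
    (hS : Summable fun n => ‖ContinuousLinearMap.adjoint S (b n)‖ ^ 2) :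
    ∃ a : ℂ, HasSum (fun n => inner ℂ (T (b n)) (S (b n))) a ∧
      HasSum (fun n => inner ℂ (ContinuousLinearMap.adjoint S (b n))
        (ContinuousLinearMap.adjoint T (b n))) a := by
  have hsum (R : H →L[ℂ] H) (hR : Summable fun n => ‖R (b n)‖ ^ 2) :
      Summable fun z : ℕ × ℕ => ‖inner ℂ (b z.2) (R (b z.1))‖ ^ 2 := by
    rw [summable_prod_of_nonneg fun z => by positivity]
    refine ⟨fun n => (hasSum_norm_inner_sq b (R (b n))).summable, ?_⟩
    refine hR.congr fun n => ?_
    exact (hasSum_norm_inner_sq b (R (b n))).tsum_eq.symm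
  set F : ℕ × ℕ → ℂ := fun z => inner ℂ (T (b z.1)) (b z.2) *
    inner ℂ (b z.2) (S (b z.1)) with hF
  have hF' (z : ℕ × ℕ) : F z = inner ℂ (ContinuousLinearMap.adjoint S (b z.2))
      (b z.1) * inner ℂ (b z.1)
        (ContinuousLinearMap.adjoint T (b z.2)) := by
    rw [ContinuousLinearMap.adjoint_inner_left, ContinuousLinearMap.adjoint_inner_right, mul_comm]
  have hsF : Summable F := by
    refine Summable.of_norm_bounded
      ((hsum T hT).add (hsum (ContinuousLinearMap.adjoint S) hS).prod_symm) fun z => ?_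
    simp only [hF, norm_mul, Prod.fst_swap, Prod.snd_swap]
    rw [ContinuousLinearMap.adjoint_inner_right, norm_inner_symm (S _), norm_inner_symm (T _)]
    nlinarith [sq_nonneg (‖inner ℂ (b z.2) (T (b z.1))‖
      - ‖inner ℂ (b z.2) (S (b z.1))‖),
      sq_nonneg ‖inner ℂ (b z.2) (T (b z.1))‖,
      sq_nonneg ‖inner ℂ (b z.2) (S (b z.1))‖]
  refine ⟨∑' z, F z, hsF.hasSum.prod_fiberwise fun n => ?_, ?_⟩
  · exact b.hasSum_inner_mul_inner (T (b n)) (S (b n))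
  · refine ((Equiv.prodComm ℕ ℕ).hasSum_iff.mpr hsF.hasSum).prod_fiberwise fun m => ?_
    have h := b.hasSum_inner_mul_inner (ContinuousLinearMap.adjoint S (b m))
      (ContinuousLinearMap.adjoint T (b m))
    exact (funext fun n => hF' (n, m)) ▸ h

lemma exists_sqrt_of_isPositive {ρ : H →L[ℂ] H} (hρ : ρ.IsPositive) :
    ∃ σ : H →L[ℂ] H, ContinuousLinearMap.adjoint σ = σ ∧ σ ∘L σ = ρ :=
  ⟨CFC.sqrt ρ, (CFC.sqrt_nonneg ρ).isSelfAdjoint,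
    CFC.sqrt_mul_sqrt_self ρ ((ContinuousLinearMap.nonneg_iff_isPositive ρ).mpr hρ)⟩

/-- A state is a mixture of vector states: with `φ_m = ρ^{1/2} h_m` one has
`tr(ρ B) = ∑ₘ ⟪φ_m, B φ_m⟫` for every bounded operator `B`. -/
lemma IsState.exists_decomposition {ρ : L2R →L[ℂ] L2R} (hρ : IsState ρ) :
    ∃ φ : ℕ → L2R, HasSum (fun m => ‖φ m‖ ^ 2) 1 ∧
      ∀ B : L2R →L[ℂ] L2R, HasSum (fun m => inner ℂ (φ m) (B (φ m))) (opTrace (ρ ∘L B)) := by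
  obtain ⟨σ, hσ, hσσ⟩ := exists_sqrt_of_isPositive hρ.isPositive
  have hin (f g : L2R) : inner ℂ (σ f) g = inner ℂ f (σ g) := by
    rw [← ContinuousLinearMap.adjoint_inner_right, hσ]
  have hsum : HasSum (fun m => ‖σ (numberBasis m)‖ ^ 2) 1 := by
    have h := hρ.hasSum_trace.mapL Complex.reCLM
    convert h using 1
    · funext m
      rw [← hσσ, ContinuousLinearMap.comp_apply, ← hin, inner_self_eq_norm_sq_to_K]
      simp only [Complex.reCLM_apply]
      norm_cast
    · simp
  refine ⟨fun m => σ (numberBasis m), hsum, fun B => ?_⟩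
  have hS : ContinuousLinearMap.adjoint (σ ∘L B) = ContinuousLinearMap.adjoint B ∘L σ := by
    rw [ContinuousLinearMap.adjoint_comp, hσ]
  obtain ⟨a, h1, h2⟩ := exists_hasSum_inner_adjoint numberBasis σ (σ ∘L B) hsum.summable (by
    refine Summable.of_nonneg_of_le (fun n => by positivity) (fun n => ?_)
      (hsum.summable.mul_left (‖ContinuousLinearMap.adjoint B‖ ^ 2))
    rw [hS, ← mul_pow]
    gcongr
    exact (ContinuousLinearMap.adjoint B).le_opNorm _)
  have ha : opTrace (ρ ∘L B) = a := by
    rw [← h1.tsum_eq, opTrace]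
    congr 1; funext n
    rw [hin, ← hσσ]; rfl
  rw [ha]
  simp only [hS, hσ] at h2
  convert h2 using 1
  funext m
  exact (ContinuousLinearMap.adjoint_inner_left _ _ _).symm

end Trace

/-! ### Square integrability of the Weyl transform -/

section WeylTransform
open FourierTransform
open scoped ENNReal

lemma integrable_conj_mul_translate (φ : L2R) (y : ℝ) :
    Integrable fun z => starRingEnd ℂ (φ z) * φ (z + y) := by
  have h2 : MemLp (fun z => φ (z + y)) 2 :=
    (Lp.memLp φ).comp_measurePreserving (measurePreserving_add_right volume y)
  exact (Lp.memLp φ).star.integrable_mul h2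

/-- As a function of `x`, a diagonal matrix element of `e^{i(xX + yP)}` is an inverse Fourier
transform, up to a phase. -/
lemma inner_weylOp_eq (φ : L2R) (x y : ℝ) :
    inner ℂ φ (weylOp x y φ) = Complex.exp (Complex.I * (x * y / 2)) *
      𝓕⁻ (fun z => starRingEnd ℂ (φ z) * φ (z + y)) (x / (2 * Real.pi)) := by
  rw [Real.fourierInv_eq', ← integral_const_mul, L2.inner_def]
  refine integral_congr_ae ?_
  filter_upwards [weylOp_ae x y φ] with z hz
  rw [hz]
  have hpi := Real.pi_ne_zero
  have e : 2 * Real.pi * inner ℝ z (x / (2 * Real.pi)) = x * z := by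
    simp; field_simp
  rw [e]
  simp only [RCLike.inner_apply, smul_eq_mul, mul_add, Complex.exp_add]
  push_cast
  rw [show (x : ℂ) * z * Complex.I = Complex.I * (x * z) by ring]
  ring

/-- Plancherel's theorem in `x` for each fixed `y`, followed by Tonelli's theorem. -/
lemma lintegral_enorm_inner_weylOp_sq (φ : L2R) :
    ∫⁻ y, ∫⁻ x, ‖inner ℂ φ (weylOp x y φ)‖ₑ ^ 2
      = ENNReal.ofReal (2 * Real.pi) * (∫⁻ z, ‖φ z‖ₑ ^ 2) ^ 2 := by
  have hm : AEMeasurable (fun p : ℝ × ℝ => ‖φ p.2‖ₑ ^ 2 * ‖φ (p.2 + p.1)‖ₑ ^ 2)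
      ((volume : Measure ℝ).prod volume) := by
    have hsm := (Lp.stronglyMeasurable φ).measurable
    fun_prop
  have hpi2 : (0 : ℝ) < 2 * Real.pi := by positivity
  -- By Tonelli's theorem almost every product `conj φ(z) φ(z + y)` is square integrable in `z`.
  have htot : ∫⁻ y, ∫⁻ z, ‖φ z‖ₑ ^ 2 * ‖φ (z + y)‖ₑ ^ 2 = (∫⁻ z, ‖φ z‖ₑ ^ 2) ^ 2 := by
    rw [lintegral_lintegral_swap hm]
    have h1 (z : ℝ) : ∫⁻ y, ‖φ z‖ₑ ^ 2 * ‖φ (z + y)‖ₑ ^ 2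
        = ‖φ z‖ₑ ^ 2 * ∫⁻ y, ‖φ y‖ₑ ^ 2 := by
      rw [lintegral_const_mul' _ _ (by simp), lintegral_add_left_eq_self (fun y => ‖φ y‖ₑ ^ 2) z]
    simp only [h1]
    rw [lintegral_mul_const'', sq]
    have hsm := (Lp.stronglyMeasurable φ).measurable
    fun_prop
  have hfin : (∫⁻ z, ‖φ z‖ₑ ^ 2) ^ 2 ≠ ∞ := by
    have h := (Lp.memLp φ).eLpNorm_lt_top
    rw [← eLpNorm_two_sq]
    finiteness
  have hae : ∀ᵐ y : ℝ, ∫⁻ z, ‖φ z‖ₑ ^ 2 * ‖φ (z + y)‖ₑ ^ 2 < ∞ := by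
    refine ae_lt_top' hm.lintegral_prod_right' ?_
    rw [htot]; exact hfin
  rw [← htot, ← lintegral_const_mul' _ _ (by finiteness)]
  refine lintegral_congr_ae ?_
  filter_upwards [hae] with y hy
  set g : ℝ → ℂ := fun z => starRingEnd ℂ (φ z) * φ (z + y) with hg
  have hgn (z : ℝ) : ‖g z‖ₑ ^ 2 = ‖φ z‖ₑ ^ 2 * ‖φ (z + y)‖ₑ ^ 2 := by
    simp only [hg, enorm_mul, mul_pow]
    congr 2
    exact RCLike.enorm_conj _
  have hg1 : Integrable g := integrable_conj_mul_translate φ y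
  have hg2 : MemLp g 2 := by
    refine ⟨hg1.aestronglyMeasurable, ?_⟩
    simp only [← hgn] at hy
    rw [← eLpNorm_two_sq] at hy
    exact (ENNReal.pow_lt_top_iff.mp hy).resolve_right two_ne_zero
  have h1 (x : ℝ) : ‖inner ℂ φ (weylOp x y φ)‖ₑ ^ 2 = ‖𝓕⁻ g ((2 * Real.pi)⁻¹ * x)‖ₑ ^ 2 := by
    rw [inner_weylOp_eq, enorm_mul, ← ofReal_norm (Complex.exp _),
      show Complex.I * (x * y / 2) = ((x * y / 2 : ℝ) : ℂ) * Complex.I by push_cast; ring,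
      Complex.norm_exp_ofReal_mul_I, ENNReal.ofReal_one, one_mul, div_eq_inv_mul]
  simp only [h1, ← hgn]
  rw [← lintegral_enorm_fourierInv_sq hg1 hg2]
  have h3 := (measurableEmbedding_mulLeft₀ (inv_ne_zero hpi2.ne')).lintegral_map
    (μ := volume) (fun x => ‖𝓕⁻ g x‖ₑ ^ 2)
  rw [Real.map_volume_mul_left (inv_ne_zero hpi2.ne'), lintegral_smul_measure, inv_inv,
    abs_of_pos hpi2] at h3
  exact h3.symm

lemma measurePreserving_plane_coords :
    MeasurePreserving (fun q : Plane => (q 0, q 1) : Plane → ℝ × ℝ) volume volume :=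
  (volume_preserving_finTwoArrow ℝ).comp
    (EuclideanSpace.volume_preserving_symm_measurableEquiv_toLp (Fin 2))

lemma continuous_inner_weylOp (φ : L2R) :
    Continuous fun q : Plane => inner ℂ φ (weylOp (q 0) (q 1) φ) := by
  have h : Continuous (fun q : Plane => (q 0, q 1) : Plane → ℝ × ℝ) := by fun_prop
  have h1 : Continuous fun q : ℝ × ℝ => inner ℂ φ (weylOp q.1 q.2 φ) := by
    have := continuous_weylOp_apply φ
    fun_prop
  have h2 := h1.comp h
  simpa only [Function.comp_def] using h2

lemma norm_inner_weylOp_le (φ : L2R) (x y : ℝ) : ‖inner ℂ φ (weylOp x y φ)‖ ≤ ‖φ‖ ^ 2 := by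
  refine (norm_inner_le_norm _ _).trans (le_of_eq ?_)
  rw [norm_weylOp_apply, sq]

lemma eLpNorm_inner_weylOp (φ : L2R) :
    eLpNorm (fun q : Plane => inner ℂ φ (weylOp (q 0) (q 1) φ)) 2 volume
      = ENNReal.ofReal (Real.sqrt (2 * Real.pi) * ‖φ‖ ^ 2) := by
  have hc : Continuous fun q : ℝ × ℝ => ‖inner ℂ φ (weylOp q.1 q.2 φ)‖ₑ ^ 2 := by
    have := continuous_weylOp_apply φ
    fun_prop
  have h1 := measurePreserving_plane_coords.lintegral_comp hc.measurable
  refine (ENNReal.pow_right_strictMono two_ne_zero).injective ?_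
  simp only
  rw [eLpNorm_two_sq, h1, Measure.volume_eq_prod, lintegral_prod_symm' _ hc.measurable,
    lintegral_enorm_inner_weylOp_sq, ← eLpNorm_two_sq, ← ENNReal.ofReal_pow (by positivity), mul_pow,
    Real.sq_sqrt (by positivity), ENNReal.ofReal_mul (p := 2 * Real.pi) (by positivity),
    ENNReal.ofReal_pow (by positivity), ENNReal.ofReal_pow (by positivity), ofReal_norm, Lp.enorm_def]

variable {ρ : L2R →L[ℂ] L2R}

lemma IsState.continuous_weylTransform (hρ : IsState ρ) : Continuous (weylTransform ρ) := by
  obtain ⟨φ, hφ, htr⟩ := hρ.exists_decomposition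
  unfold weylTransform
  simp only [← (htr _).tsum_eq]
  exact continuous_const.mul (continuous_tsum (fun m => continuous_inner_weylOp (φ m)) hφ.summable
    fun m q => norm_inner_weylOp_le _ _ _)

/-- The Weyl transform of a vector state `φ` has `L²` norm proportional to `‖φ‖²`, so the series
over a decomposition into vector states converges in `L²`. -/
lemma IsState.memLp_weylTransform (hρ : IsState ρ) : MemLp (weylTransform ρ) 2 volume := by
  refine ⟨hρ.continuous_weylTransform.aestronglyMeasurable, ?_⟩
  obtain ⟨φ, hφ, htr⟩ := hρ.exists_decomposition
  have hM (m : ℕ) : AEStronglyMeasurable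
      (fun q : Plane => inner ℂ (φ m) (weylOp (q 0) (q 1) (φ m))) volume :=
    (continuous_inner_weylOp (φ m)).aestronglyMeasurable
  have hle : eLpNorm (fun q : Plane => opTrace (ρ ∘L weylOp (q 0) (q 1))) 2 volume
      ≤ ENNReal.ofReal (Real.sqrt (2 * Real.pi)) := by
    have h := Lp.eLpNorm_lim_le_liminf_eLpNorm (p := 2) (μ := volume)
      (f := fun N => ∑ m ∈ Finset.range N, fun q : Plane => inner ℂ (φ m) (weylOp (q 0) (q 1) (φ m)))
      (fun N => Finset.aestronglyMeasurable_sum _ fun m _ => hM m)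
      (fun q : Plane => opTrace (ρ ∘L weylOp (q 0) (q 1)))
      (Filter.Eventually.of_forall fun q => by
        simpa only [Finset.sum_apply] using (htr (weylOp (q 0) (q 1))).tendsto_sum_nat)
    refine h.trans ?_
    refine (Filter.liminf_le_liminf (v := fun _ => ENNReal.ofReal (Real.sqrt (2 * Real.pi)))
      (Filter.Eventually.of_forall fun N => ?_)).trans_eq (Filter.liminf_const _)
    refine (eLpNorm_sum_le (fun m _ => hM m) (by norm_num)).trans ?_
    simp only [eLpNorm_inner_weylOp]
    rw [← ENNReal.ofReal_sum_of_nonneg fun m _ => by positivity, ← Finset.mul_sum]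
    refine ENNReal.ofReal_le_ofReal (mul_le_of_le_one_right (by positivity) ?_)
    exact sum_le_hasSum _ (fun m _ => by positivity) hφ
  have hM' : MemLp (fun q : Plane => opTrace (ρ ∘L weylOp (q 0) (q 1))) 2 volume := by
    refine ⟨?_, hle.trans_lt ENNReal.ofReal_lt_top⟩
    have hpi : ((1 / Real.sqrt (2 * Real.pi) : ℝ) : ℂ) ≠ 0 := by
      exact_mod_cast (by positivity : (1 / Real.sqrt (2 * Real.pi) : ℝ) ≠ 0)
    have := (hρ.continuous_weylTransform.const_mul ((1 / Real.sqrt (2 * Real.pi) : ℝ) : ℂ)⁻¹)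
    refine (this.congr fun q => ?_).aestronglyMeasurable
    rw [weylTransform, inv_mul_cancel_left₀ hpi]
  exact (hM'.const_mul ((1 / Real.sqrt (2 * Real.pi) : ℝ) : ℂ)).eLpNorm_lt_top

end WeylTransform

/-! ### Quadrature distributions and the homodyne density -/

section Quadrature
open scoped ENNReal
open ProbabilityTheory

variable {ρ : L2R →L[ℂ] L2R}

/-- The position distribution `∑ₘ |ψ_m(x)|² dx` of the mixture of the vector states `ψ_m`. -/
noncomputable def mixtureMeasure (ψ : ℕ → L2R) : Measure ℝ :=
  volume.withDensity fun x => ∑' m, ‖ψ m x‖ₑ ^ 2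

lemma measurable_enorm_sq (f : L2R) : Measurable fun x => ‖f x‖ₑ ^ 2 := by
  have := (Lp.stronglyMeasurable f).measurable
  fun_prop

lemma lintegral_enorm_sq (f : L2R) : ∫⁻ x, ‖f x‖ₑ ^ 2 = ENNReal.ofReal (‖f‖ ^ 2) := by
  rw [← eLpNorm_two_sq, ENNReal.ofReal_pow (by positivity), ofReal_norm, Lp.enorm_def]

lemma mixtureMeasure_apply (ψ : ℕ → L2R) {A : Set ℝ} (hA : MeasurableSet A) :
    mixtureMeasure ψ A = ∑' m, ‖posProj A (ψ m)‖ₑ ^ 2 := by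
  rw [mixtureMeasure, withDensity_apply _ hA,
    lintegral_tsum fun m => (measurable_enorm_sq _).aemeasurable]
  congr 1; funext m
  rw [Lp.enorm_def, eLpNorm_two_sq, ← lintegral_indicator hA]
  refine lintegral_congr_ae ?_
  filter_upwards [posProj_ae hA (ψ m)] with x hx
  rw [hx]
  by_cases h : x ∈ A <;> simp [h]

lemma mixtureMeasure_univ {ψ : ℕ → L2R} (hψ : HasSum (fun m => ‖ψ m‖ ^ 2) 1) :
    mixtureMeasure ψ Set.univ = 1 := by
  rw [mixtureMeasure, withDensity_apply _ MeasurableSet.univ, Measure.restrict_univ,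
    lintegral_tsum fun m => (measurable_enorm_sq _).aemeasurable]
  simp only [lintegral_enorm_sq]
  rw [← ENNReal.ofReal_tsum_of_nonneg (fun m => by positivity) hψ.summable, hψ.tsum_eq,
    ENNReal.ofReal_one]

/-- The expectation of a function of position, given by the multiplication operator `B`. -/
lemma hasSum_inner_mixtureMeasure {ψ : ℕ → L2R} (hψ : HasSum (fun m => ‖ψ m‖ ^ 2) 1)
    {g : ℝ → ℂ} (hg : Measurable g) (hb : ∀ x, ‖g x‖ ≤ 1) {B : L2R →L[ℂ] L2R}
    (hB : ∀ m, B (ψ m) =ᵐ[volume] fun x => g x * ψ m x) :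
    HasSum (fun m => inner ℂ (ψ m) (B (ψ m))) (∫ x, g x ∂mixtureMeasure ψ) := by
  have : IsProbabilityMeasure (mixtureMeasure ψ) := ⟨mixtureMeasure_univ hψ⟩
  have hi : Integrable g (mixtureMeasure ψ) :=
    .of_bound hg.aestronglyMeasurable 1 (Filter.Eventually.of_forall hb)
  have hs : mixtureMeasure ψ = Measure.sum fun m => volume.withDensity fun x => ‖ψ m x‖ₑ ^ 2 := by
    rw [mixtureMeasure, ← withDensity_tsum fun m => measurable_enorm_sq (ψ m)]
    congr 1; funext x; rw [tsum_apply (Pi.summable.mpr fun _ => ENNReal.summable)]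
  rw [hs] at hi ⊢
  refine (hasSum_integral_measure hi).congr_fun fun m => ?_
  rw [integral_withDensity_eq_integral_toReal_smul (measurable_enorm_sq _)
    (Filter.Eventually.of_forall fun x => by finiteness), L2.inner_def]
  refine integral_congr_ae ?_
  filter_upwards [hB m] with x hx
  rw [hx, RCLike.inner_apply, mul_assoc, Complex.mul_conj, Complex.normSq_eq_norm_sq]
  simp [mul_comm]

/-- For fixed `f` the vector `V(θ) f` is the limit of the partial sums of its expansion in the
number basis, which are continuous in `θ`. -/
lemma stronglyMeasurable_numberRot (f : L2R) : StronglyMeasurable fun θ => numberRot θ f := by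
  refine stronglyMeasurable_of_tendsto Filter.atTop
    (g := fun θ => numberRot θ f) (f := fun (N : ℕ) (θ : ℝ) => ∑ n ∈ Finset.range N,
      (Complex.exp (Complex.I * θ * n) * inner ℂ (numberBasis n) f) • numberBasis n)
    (fun N => ?_) (tendsto_pi_nhds.mpr fun θ => ?_)
  · refine Continuous.stronglyMeasurable (continuous_finsetSum _ fun n _ => ?_)
    have hc : Continuous fun θ : ℝ =>
        Complex.exp (Complex.I * θ * n) * inner ℂ (numberBasis n) f := by fun_prop
    exact hc.smul continuous_const
  · have h := (numberBasis.hasSum_repr (numberRot θ f)).tendsto_sum_nat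
    simpa only [HilbertBasis.repr_apply_apply, inner_numberBasis_numberRot] using h

/-- The distribution of the quadrature `X_θ` in the mixture of the vector states `φ_m`, as a
Markov kernel in the phase `θ`. -/
noncomputable def quadKernel (φ : ℕ → L2R) : Kernel ℝ ℝ where
  toFun θ := mixtureMeasure fun m => numberRot (-θ) (φ m)
  measurable' := by
    refine Measure.measurable_of_measurable_coe _ fun A hA => ?_
    simp only [mixtureMeasure_apply _ hA]
    refine Measurable.tsum fun m => ?_
    have h : StronglyMeasurable fun θ : ℝ => posProj A (numberRot (-θ) (φ m)) :=
      (posProj A).continuous.comp_stronglyMeasurable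
        ((stronglyMeasurable_numberRot (φ m)).comp_measurable measurable_neg)
    exact h.enorm.pow_const 2

lemma isMarkovKernel_quadKernel {φ : ℕ → L2R} (hφ : HasSum (fun m => ‖φ m‖ ^ 2) 1) :
    IsMarkovKernel (quadKernel φ) :=
  ⟨fun θ => ⟨mixtureMeasure_univ (by simpa using hφ)⟩⟩

lemma quadKernel_absolutelyContinuous (φ : ℕ → L2R) (θ : ℝ) : quadKernel φ θ ≪ volume :=
  withDensity_absolutelyContinuous _ _

instance : IsFiniteMeasure phaseMeasure := by
  unfold phaseMeasure
  exact Measure.smul_finite _ ENNReal.ofReal_ne_top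

instance : SigmaFinite phaseSpaceMeasure := by
  unfold phaseSpaceMeasure; infer_instance

/-- Expectations of functions of the quadrature `X_θ = V(θ) X V(θ)*` are integrals against its
distribution. -/
lemma opTrace_conj_numberRot {φ : ℕ → L2R} (hφ : HasSum (fun m => ‖φ m‖ ^ 2) 1)
    (htr : ∀ B : L2R →L[ℂ] L2R, HasSum (fun m => inner ℂ (φ m) (B (φ m))) (opTrace (ρ ∘L B)))
    (θ : ℝ) {g : ℝ → ℂ} (hg : Measurable g) (hb : ∀ x, ‖g x‖ ≤ 1) {B : L2R →L[ℂ] L2R}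
    (hB : ∀ f : L2R, B f =ᵐ[volume] fun x => g x * f x) :
    opTrace (ρ ∘L (numberRot θ : L2R →L[ℂ] L2R) ∘L B ∘L
      ContinuousLinearMap.adjoint (numberRot θ : L2R →L[ℂ] L2R)) = ∫ x, g x ∂quadKernel φ θ := by
  have h := hasSum_inner_mixtureMeasure (ψ := fun m => numberRot (-θ) (φ m)) (by simpa using hφ)
    hg hb (B := B) fun m => hB _
  refine (htr _).unique ?_
  refine h.congr_fun fun m => ?_
  rw [ContinuousLinearMap.comp_apply, ← ContinuousLinearMap.adjoint_inner_left,
    ContinuousLinearMap.comp_apply, adjoint_numberRot]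
  rfl

variable {φ : ℕ → L2R}

lemma quadProb_eq_quadKernel (hφ : HasSum (fun m => ‖φ m‖ ^ 2) 1)
    (htr : ∀ B : L2R →L[ℂ] L2R, HasSum (fun m => inner ℂ (φ m) (B (φ m))) (opTrace (ρ ∘L B)))
    (θ : ℝ) {A : Set ℝ} (hA : MeasurableSet A) :
    quadProb ρ θ A = ((quadKernel φ θ).real A : ℂ) := by
  have h := opTrace_conj_numberRot hφ htr θ (g := A.indicator 1) (measurable_one.indicator hA)
    (fun x => by by_cases h : x ∈ A <;> simp [h]) (B := posProj A) fun f => by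
      filter_upwards [posProj_ae hA f] with x hx
      rw [hx]
      by_cases h : x ∈ A <;> simp [h]
  rw [quadProb, quadProj, h, integral_indicator hA]
  simp

/-- The characteristic function of the quadrature `X_θ`. -/
lemma opTrace_weylOp_polar (hφ : HasSum (fun m => ‖φ m‖ ^ 2) 1)
    (htr : ∀ B : L2R →L[ℂ] L2R, HasSum (fun m => inner ℂ (φ m) (B (φ m))) (opTrace (ρ ∘L B)))
    (θ s : ℝ) : opTrace (ρ ∘L weylOp (s * Real.cos θ) (s * Real.sin θ))
      = ∫ x : ℝ, Complex.exp (Complex.I * (s * x)) ∂quadKernel φ θ := by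
  rw [weylOp_polar]
  refine opTrace_conj_numberRot hφ htr θ (by fun_prop) (fun x => ?_) fun f => ?_
  · rw [show Complex.I * (s * x) = ((s * x : ℝ) : ℂ) * Complex.I by push_cast; ring,
      Complex.norm_exp_ofReal_mul_I]
  · filter_upwards [weylOp_ae s 0 f] with x hx
    rw [hx]; simp

lemma homodyneProb_eq_compProd (hφ : HasSum (fun m => ‖φ m‖ ^ 2) 1)
    (htr : ∀ B : L2R →L[ℂ] L2R, HasSum (fun m => inner ℂ (φ m) (B (φ m))) (opTrace (ρ ∘L B)))
    {B : Set (ℝ × ℝ)} (hB : MeasurableSet B) :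
    homodyneProb ρ B = (((phaseMeasure ⊗ₘ quadKernel φ).real B : ℝ) : ℂ) := by
  have := isMarkovKernel_quadKernel hφ
  have hsec (θ : ℝ) := quadProb_eq_quadKernel hφ htr θ (A := {x | (θ, x) ∈ B})
    (measurable_prodMk_left hB)
  simp only [homodyneProb, hsec]
  rw [integral_complex_ofReal, measureReal_def, Measure.compProd_apply hB]
  congr 1
  simp only [measureReal_def]
  rw [integral_toReal]
  · rfl
  · exact (Kernel.measurable_kernel_prodMk_left hB).aemeasurable
  · exact Filter.Eventually.of_forall fun θ => measure_lt_top _ _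

/-- The homodyne density is the Radon–Nikodym derivative of the homodyne measure: each quadrature
distribution is absolutely continuous, hence so is their mixture over the phase. -/
lemma IsState.exists_isHomodyneDensity (hρ : IsState ρ) :
    ∃ p : ℝ × ℝ → ℝ, IsHomodyneDensity ρ p := by
  obtain ⟨φ, hφ, htr⟩ := hρ.exists_decomposition
  have := isMarkovKernel_quadKernel hφ
  have hac : phaseMeasure ⊗ₘ quadKernel φ ≪ phaseSpaceMeasure := by
    rw [phaseSpaceMeasure, ← Measure.compProd_const]
    exact Measure.AbsolutelyContinuous.compProd_right
      (Filter.Eventually.of_forall fun θ => by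
        rw [Kernel.const_apply]; exact quadKernel_absolutelyContinuous φ θ)
  refine ⟨fun z => ((phaseMeasure ⊗ₘ quadKernel φ).rnDeriv phaseSpaceMeasure z).toReal,
    Measure.integrable_toReal_rnDeriv, fun B hB => ?_, fun B hB => ?_⟩
  · have hsec (θ : ℝ) := quadProb_eq_quadKernel hφ htr θ (A := {x | (θ, x) ∈ B})
      (measurable_prodMk_left hB)
    simp only [hsec]
    have hm : Measurable fun θ => (quadKernel φ θ).real {x | (θ, x) ∈ B} :=
      (Kernel.measurable_kernel_prodMk_left hB).ennreal_toReal
    refine (Integrable.of_bound hm.aestronglyMeasurable 1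
      (Filter.Eventually.of_forall fun θ => ?_)).ofReal
    rw [Real.norm_of_nonneg measureReal_nonneg]
    exact measureReal_le_one
  · rw [homodyneProb_eq_compProd hφ htr hB, Measure.setIntegral_toReal_rnDeriv hac]

end Quadrature

/-! ### The Fourier slice theorem and inversion -/

section Radon
open FourierTransform
open scoped ENNReal
open ProbabilityTheory

/-- Rotation of the plane by the angle `θ`. -/
noncomputable def planeRot (θ : ℝ) : Plane →ₗᵢ[ℝ] Plane where
  toFun q := linePoint θ (q 0) (q 1)
  map_add' p q := by
    ext i; fin_cases i <;> simp [linePoint] <;> ring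
  map_smul' c q := by
    ext i; fin_cases i <;> simp [linePoint] <;> ring
  norm_map' q := by
    simp only [LinearMap.coe_mk, AddHom.coe_mk, EuclideanSpace.norm_eq, linePoint]
    congr 1
    simp only [Fin.sum_univ_two, Real.norm_eq_abs, sq_abs]
    simp
    linear_combination (q 0 ^ 2 + q 1 ^ 2) * Real.cos_sq_add_sin_sq θ

lemma measurePreserving_linePoint (θ : ℝ) :
    MeasurePreserving (fun z : ℝ × ℝ => linePoint θ z.1 z.2) volume volume := by
  have h1 : MeasurePreserving (fun z : ℝ × ℝ => (!₂[z.1, z.2] : Plane)) volume volume :=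
    (PiLp.volume_preserving_toLp (Fin 2)).comp (volume_preserving_finTwoArrow ℝ).symm
  have h2 := ((planeRot θ).toLinearIsometryEquiv rfl).measurePreserving.comp h1
  exact h2

lemma measurable_linePoint : Measurable fun z : ℝ × ℝ × ℝ => linePoint z.1 z.2.1 z.2.2 := by
  have : Continuous fun z : ℝ × ℝ × ℝ => linePoint z.1 z.2.1 z.2.2 := by
    unfold linePoint
    refine (PiLp.continuous_toLp 2 _).comp (continuous_pi fun i => ?_)
    fin_cases i <;> simp <;> fun_prop
  exact this.measurable

/-- An integrable function on the plane is jointly integrable in the coordinates `(θ, r, t)`. -/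
lemma integrable_comp_linePoint {f : Plane → ℂ} (hf : Integrable f) :
    Integrable (fun z : (ℝ × ℝ) × ℝ => f (linePoint z.1.1 z.1.2 z.2))
      (phaseSpaceMeasure.prod volume) := by
  have hmp : MeasurePreserving (fun z : ℝ × ℝ × ℝ => (z.1, linePoint z.1 z.2.1 z.2.2))
      (phaseMeasure.prod volume) (phaseMeasure.prod volume) :=
    (MeasurePreserving.id phaseMeasure).skew_product
      (g := fun (θ : ℝ) (z : ℝ × ℝ) => linePoint θ z.1 z.2)
      measurable_linePoint
      (Filter.Eventually.of_forall fun θ => (measurePreserving_linePoint θ).map_eq)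
  have h1 := hmp.integrable_comp_of_integrable (hf.comp_snd phaseMeasure)
  exact (measurePreserving_prodAssoc phaseMeasure volume volume).integrable_comp_of_integrable h1

/-- The Fourier slice theorem: the one-dimensional transform of `Rf(θ, ·)` is the restriction of the
two-dimensional transform of `f` to a line through the origin. -/
lemma integral_exp_mul_radon {f : Plane → ℂ} (hf : Integrable f) (θ s : ℝ) :
    Integrable (radon f θ) ∧ ∫ r : ℝ, Complex.exp (Complex.I * (s * r)) * radon f θ r =
      ∫ q : Plane, Complex.exp (Complex.I * (s * Real.cos θ * q 0 + s * Real.sin θ * q 1)) * f q := by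
  have hmp := measurePreserving_linePoint θ
  have h1 : Integrable (fun z : ℝ × ℝ => f (linePoint θ z.1 z.2)) (volume.prod volume) :=
    hmp.integrable_comp_of_integrable hf
  refine ⟨h1.integral_prod_left, ?_⟩
  set g : Plane → ℂ := fun q =>
    Complex.exp (Complex.I * (s * Real.cos θ * q 0 + s * Real.sin θ * q 1)) * f q with hg
  have hgi : Integrable g := by
    refine hf.bdd_mul (c := 1) (Continuous.aestronglyMeasurable (by fun_prop))
      (Filter.Eventually.of_forall fun q => ?_)
    rw [show Complex.I * (s * Real.cos θ * q 0 + s * Real.sin θ * q 1)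
      = ((s * Real.cos θ * q 0 + s * Real.sin θ * q 1 : ℝ) : ℂ) * Complex.I by push_cast; ring,
      Complex.norm_exp_ofReal_mul_I]
  have h2 : Integrable (fun z : ℝ × ℝ => g (linePoint θ z.1 z.2)) (volume.prod volume) :=
    hmp.integrable_comp_of_integrable hgi
  have h3 : ∫ q, g q = ∫ z : ℝ × ℝ, g (linePoint θ z.1 z.2) := by
    rw [← hmp.map_eq, integral_map hmp.aemeasurable (hmp.map_eq ▸ hgi.aestronglyMeasurable)]
  rw [h3, Measure.volume_eq_prod, integral_prod _ h2]
  congr 1; funext r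
  rw [radon, ← integral_const_mul]
  congr 1; funext t
  have e : s * Real.cos θ * linePoint θ r t 0 + s * Real.sin θ * linePoint θ r t 1 = s * r := by
    simp only [linePoint]
    simp
    linear_combination s * r * Real.cos_sq_add_sin_sq θ
  have e' := congrArg (fun t : ℝ => (t : ℂ)) e
  push_cast at e'
  simp only [hg]
  push_cast
  rw [e']

variable {ρ : L2R →L[ℂ] L2R}

/-- Fourier inversion for the Wigner function. The identity holds almost everywhere by inversion in
`L²`, and everywhere because both sides are continuous. -/
lemma IsState.opTrace_weylOp_eq_integral_wigner (hρ : IsState ρ) (hW : Integrable (wigner ρ))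
    (q : Plane) : opTrace (ρ ∘L weylOp (q 0) (q 1)) =
      ∫ ξ : Plane, Complex.exp (Complex.I * (q 0 * ξ 0 + q 1 * ξ 1)) * wigner ρ ξ := by
  have hpi : (0 : ℝ) < 2 * Real.pi := by positivity
  have hpi0 := hpi.ne'
  set c : ℝ := Real.sqrt (2 * Real.pi) with hc
  have hc0 : (c : ℂ) ≠ 0 := by exact_mod_cast (by positivity : c ≠ 0)
  have hc2 : (c : ℂ) ^ 2 = 2 * Real.pi := by
    rw [← Complex.ofReal_pow, hc, Real.sq_sqrt hpi.le]; push_cast; ring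
  have hL := hρ.memLp_weylTransform
  -- `F` is a rescaling of `W(ρ)`, hence integrable, and its inverse transform is `V(ρ)`.
  set u : L2Plane := hL.toLp (weylTransform ρ) with hu
  set F : L2Plane := 𝓕 u with hF
  have hWF (η : Plane) : F η = c ^ 3 * wigner ρ ((2 * Real.pi) • η) := by
    rw [wigner, dif_pos hL, fourierPlane, smul_smul, one_div_mul_cancel hpi0, one_smul, ← hF,
      ← hc]
    push_cast
    rw [← hc2]
    field_simp
  have hFi : Integrable F := by
    have := (hW.comp_smul hpi0).const_mul ((c : ℂ) ^ 3)
    exact this.congr (Filter.Eventually.of_forall fun η => (hWF η).symm)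
  have hinv : (u : Plane → ℂ) =ᵐ[volume] 𝓕⁻ (F : Plane → ℂ) := by
    have h := fourierInv_toLp_ae hFi (Lp.memLp F)
    rwa [Lp.toLp_coeFn, hF, fourierInv_fourier_eq] at h
  have hcont := continuous_fourierInv hFi
  have heq : weylTransform ρ = 𝓕⁻ (F : Plane → ℂ) :=
    (hρ.continuous_weylTransform.ae_eq_iff_eq volume hcont).mp (hL.coeFn_toLp.symm.trans hinv)
  have hq := congrFun heq q
  set k : Plane → ℂ := fun ξ => Complex.exp (Complex.I * (q 0 * ξ 0 + q 1 * ξ 1)) * wigner ρ ξ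
    with hk
  have h1 : 𝓕⁻ (F : Plane → ℂ) q = ∫ η : Plane, c ^ 3 * k ((2 * Real.pi) • η) := by
    rw [Real.fourierInv_eq']
    congr 1; funext η
    have e : inner ℝ η q = q 0 * η 0 + q 1 * η 1 := by
      simp [PiLp.inner_apply, Fin.sum_univ_two]
    rw [hWF, e, smul_eq_mul]
    simp only [hk, PiLp.smul_apply, smul_eq_mul]
    push_cast
    rw [show 2 * (Real.pi : ℂ) * (q 0 * η 0 + q 1 * η 1) * Complex.I
      = Complex.I * (q 0 * (2 * Real.pi * η 0) + q 1 * (2 * Real.pi * η 1)) by ring]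
    ring
  rw [h1, integral_const_mul, Measure.integral_comp_smul, weylTransform, ← hc] at hq
  simp only [finrank_euclideanSpace, Fintype.card_fin, abs_of_pos (inv_pos.mpr (pow_pos hpi 2)),
    Complex.real_smul] at hq
  push_cast at hq
  rw [← hc2] at hq
  field_simp at hq
  exact hq

/-- The Radon transform of the Wigner function along the phase `θ` is the density of the quadrature
`X_θ`: both have the same Fourier transform. -/
lemma IsState.setIntegral_radon_wigner (hρ : IsState ρ) (hW : Integrable (wigner ρ)) (θ : ℝ)
    {A : Set ℝ} (hA : MeasurableSet A) :
    ∫ r in A, radon (wigner ρ) θ r = quadProb ρ θ A := by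
  obtain ⟨φ, hφ, htr⟩ := hρ.exists_decomposition
  have := isMarkovKernel_quadKernel hφ
  set ν := quadKernel φ θ
  have hac : ν ≪ volume := quadKernel_absolutelyContinuous φ θ
  set d : ℝ → ℝ := fun x => (ν.rnDeriv volume x).toReal
  have hd : Integrable d := Measure.integrable_toReal_rnDeriv
  have hR : Integrable (radon (wigner ρ) θ) := (integral_exp_mul_radon hW θ 0).1
  have hz : ∀ᵐ x, radon (wigner ρ) θ x - (d x : ℂ) = 0 := by
    refine ae_eq_zero_of_fourier_eq_zero (hR.sub hd.ofReal) fun w => ?_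
    rw [Real.fourier_real_eq_integral_exp_smul]
    set s : ℝ := -2 * Real.pi * w with hs
    have hb : ∀ᵐ x : ℝ, ‖Complex.exp (Complex.I * (s * x))‖ ≤ 1 :=
        Filter.Eventually.of_forall fun x => by
      rw [show Complex.I * (s * x) = ((s * x : ℝ) : ℂ) * Complex.I by push_cast; ring,
        Complex.norm_exp_ofReal_mul_I]
    have hm : AEStronglyMeasurable (fun x : ℝ => Complex.exp (Complex.I * (s * x))) volume :=
      Continuous.aestronglyMeasurable (by fun_prop)
    have e (x : ℝ) : Complex.exp (((-2 * Real.pi * x * w : ℝ) : ℂ) * Complex.I) •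
        (radon (wigner ρ) θ x - (d x : ℂ)) =
        Complex.exp (Complex.I * (s * x)) * radon (wigner ρ) θ x
          - Complex.exp (Complex.I * (s * x)) * d x := by
      rw [smul_eq_mul, mul_sub, hs]
      push_cast
      rw [show -2 * (Real.pi : ℂ) * x * w * Complex.I = Complex.I * (-2 * Real.pi * w * x) by ring]
    have hI : Integrable fun x : ℝ => Complex.exp (Complex.I * (s * x)) * (d x : ℂ) :=
      hd.ofReal.bdd_mul hm hb
    simp only [e]
    rw [integral_sub (hR.bdd_mul hm hb) hI, sub_eq_zero,
      (integral_exp_mul_radon hW θ s).2]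
    have h1 := hρ.opTrace_weylOp_eq_integral_wigner hW !₂[s * Real.cos θ, s * Real.sin θ]
    simp only [Matrix.cons_val_zero, Matrix.cons_val_one] at h1
    rw [opTrace_weylOp_polar hφ htr] at h1
    push_cast at h1 ⊢
    rw [← h1, ← integral_rnDeriv_smul hac]
    congr 1; funext x
    rw [Complex.real_smul, mul_comm]
  rw [quadProb_eq_quadKernel hφ htr θ hA, ← Measure.setIntegral_toReal_rnDeriv hac A,
    ← integral_complex_ofReal]
  refine integral_congr_ae (ae_restrict_of_ae ?_)
  filter_upwards [hz] with x hx
  exact sub_eq_zero.mp hx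

lemma IsState.setIntegral_radon_wigner_eq_homodyneProb (hρ : IsState ρ)
    (hW : Integrable (wigner ρ)) {B : Set (ℝ × ℝ)} (hB : MeasurableSet B) :
    ∫ z in B, radon (wigner ρ) z.1 z.2 ∂phaseSpaceMeasure = homodyneProb ρ B := by
  have hR : Integrable (fun z : ℝ × ℝ => radon (wigner ρ) z.1 z.2) phaseSpaceMeasure :=
    (integrable_comp_linePoint hW).integral_prod_left
  rw [← integral_indicator hB, phaseSpaceMeasure, integral_prod _ (hR.indicator hB), homodyneProb]
  congr 1; funext θ
  have hBθ : MeasurableSet {x | (θ, x) ∈ B} := measurable_prodMk_left hB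
  rw [← hρ.setIntegral_radon_wigner hW θ hBθ, ← integral_indicator hBθ]
  rfl

end Radon
end Homodyne

theorem proposition4p1 (ρ : Homodyne.L2R →L[ℂ] Homodyne.L2R) (hρ : Homodyne.IsState ρ) :
    -- `V(ρ) ∈ L²(ℝ²)`, so that `W(ρ)` is defined, and the density `p^ρ` exists
    MemLp (Homodyne.weylTransform ρ) 2 volume ∧
    (∃ p : ℝ × ℝ → ℝ, Homodyne.IsHomodyneDensity ρ p) ∧
    (Integrable (Homodyne.wigner ρ) volume →
      Integrable (fun z : ℝ × ℝ => Homodyne.radon (Homodyne.wigner ρ) z.1 z.2)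
        Homodyne.phaseSpaceMeasure ∧
      ∀ p : ℝ × ℝ → ℝ, Homodyne.IsHomodyneDensity ρ p →
        ∀ᵐ z ∂Homodyne.phaseSpaceMeasure,
          Integrable (fun t => Homodyne.wigner ρ (Homodyne.linePoint z.1 z.2 t)) volume ∧
          Homodyne.radon (Homodyne.wigner ρ) z.1 z.2 = (p z : ℂ)) := by
  refine ⟨hρ.memLp_weylTransform, hρ.exists_isHomodyneDensity, fun hW => ?_⟩
  have hj := Homodyne.integrable_comp_linePoint hW
  have hR : Integrable (fun z : ℝ × ℝ => Homodyne.radon (Homodyne.wigner ρ) z.1 z.2)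
      Homodyne.phaseSpaceMeasure := hj.integral_prod_left
  refine ⟨hR, fun p hp => hj.prod_right_ae.and ?_⟩
  refine hR.ae_eq_of_forall_setIntegral_eq _ _ hp.integrable.ofReal fun B hB _ => ?_
  rw [hρ.setIntegral_radon_wigner_eq_homodyneProb hW hB, hp.homodyneProb_eq B hB,
    integral_complex_ofReal]
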